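/- A graphon is a symmetric Lebesgue-measurable function $W:[0,1]^2\to[0,1]$; it is constant if it is almost everywhere equal to some constant. Let $\lambda$ be the Lebesgue measure on $[0,1]$. For graphons $U,V$ let $$d_\Box(U,V)=\sup_{A,B}\Big|\int_{A\times B}(U-V)\,d\lambda^{\otimes 2}\Big|,\qquad \delta_\Box(U,V)=\inf_{\varphi,\psi} d_\Box(U^\varphi,V^\psi),$$ where $A,B$ range over measurable subsets of $[0,1]$, $\varphi,\psi$ range over measure-preserving maps $[0,1]\to[0,1]$, and $U^\varphi(x,y)=U(\varphi(x),\varphi(y))$. Graphons $U,V$ are weakly isomorphic if $\delta_\Box(U,V)=0$. For a graphon $W$ and a Borel probability measure $\mu\ll\lambda$ on $[0,1]$ let $W_\mu=W^\varphi$, where $\varphi:([0,1],\lambda)\to([0,1],\mu)$ is any fixed measure-preserving map. Let $\mathbf{RN}(W)$ be the $\delta_\Box$-closure of the set of graphons weakly isomorphic to $W_\mu$ for some Borel probability measure $\mu\ll\lambda$, and let $$K_W(U)=\inf\Big\{\int_{[0,1]}\frac{d\mu}{d\lambda}\log\frac{d\mu}{d\lambda}\,d\lambda \;:\; \mu\ll\lambda\text{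 a Borel probability measure on }[0,1],\ \delta_\Box(U,W_\mu)=0\Big\},$$ where $0\log 0=0$ and $\inf\emptyset=\infty$. Proposition. Let $W$ be a graphon. Then $K_W$ takes the same value at weakly isomorphic graphons, and: (a) $K_W(U)\ge 0$ for every graphon $U$; (b) for every graphon $U$, $K_W(U)=0$ if and only if $\delta_\Box(W,U)=0$; (c) $\{U: K_W(U)<\infty\}$ is a subset of $\mathbf{RN}(W)$ and is dense in it with respect to $\delta_\Box$; (d) $K_W$ is lower semicontinuous with respect to $\delta_\Box$, i.e. $\{U:K_W(U)\le\rho\}$ is $\delta_\Box$-closed for every $\rho\in\mathbb R$; (e) if $W$ is not constant, then $\mathbf{RN}(W)$ contains two graphons that are not weakly isomorphic, and there is a graphon $U$ with $0<K_W(U)<\infty$. -/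

import Mathlib

open MeasureTheory Set
open scoped unitInterval ENNReal

noncomputable section

/-- A graphon: a symmetric function `[0,1]² → [0,1]` that is Lebesgue measurable, i.e. measurable
with respect to the completion of the Borel σ-algebra by the Lebesgue measure. -/
structure Graphon where
  toFun : I → I → ℝ
  nonneg : ∀ x y, 0 ≤ toFun x y
  le_one : ∀ x y, toFun x y ≤ 1
  symm : ∀ x y, toFun x y = toFun y x
  measurable : NullMeasurable (fun p : I × I => toFun p.1 p.2) volume

namespace Graphon

/-- `W` is constant: almost everywhere equal to some constant `c`. -/
def IsConstant (W : Graphon) : Prop :=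
  ∃ c : ℝ, ∀ᵐ p : I × I, W.toFun p.1 p.2 = c

/-- `φ : ([0,1], λ) → ([0,1], μ)` is measure preserving. As usual for graphons, `φ` is only
required to be Lebesgue measurable. -/
structure MeasPres (φ : I → I) (μ : Measure I) : Prop where
  nullMeasurable : NullMeasurable φ volume
  map_eq : (volume : Measure I).map φ = μ

/-- The pull-back `W^φ(x,y) = W(φ(x), φ(y))` along a measure-preserving map
`φ : ([0,1], λ) → ([0,1], μ)` with `μ ≪ λ`. -/
def pullback (W : Graphon) (φ : I → I) {μ : Measure I} (hφ : MeasPres φ μ) (hμ : μ ≪ volume) :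
    Graphon where
  toFun x y := W.toFun (φ x) (φ y)
  nonneg _ _ := W.nonneg _ _
  le_one _ _ := W.le_one _ _
  symm _ _ := W.symm _ _
  measurable := by
    have hφm : AEMeasurable φ volume := hφ.nullMeasurable.aemeasurable
    set ψ := hφm.mk φ with hψ
    have hψm : Measurable ψ := hφm.measurable_mk
    have hφψ : φ =ᵐ[volume] ψ := hφm.ae_eq_mk
    have hq : Measure.QuasiMeasurePreserving ψ volume volume := by
      refine ⟨hψm, ?_⟩
      rw [← Measure.map_congr hφψ, hφ.map_eq]
      exact hμ
    have hqq : Measure.QuasiMeasurePreserving (Prod.map ψ ψ) (volume : Measure (I × I))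
        (volume : Measure (I × I)) := by
      refine ⟨hψm.prodMap hψm, ?_⟩
      rw [Measure.volume_eq_prod, ← Measure.map_prod_map _ _ hψm hψm]
      exact hq.absolutelyContinuous.prod hq.absolutelyContinuous
    have h1 : AEMeasurable (fun p : I × I => W.toFun (ψ p.1) (ψ p.2)) volume :=
      W.measurable.aemeasurable.comp_quasiMeasurePreserving hqq
    have hfst : ∀ᵐ p : I × I, φ p.1 = ψ p.1 :=
      Measure.quasiMeasurePreserving_fst.ae hφψ
    have hsnd : ∀ᵐ p : I × I, φ p.2 = ψ p.2 :=
      Measure.quasiMeasurePreserving_snd.ae hφψ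
    refine (h1.congr ?_).nullMeasurable
    filter_upwards [hfst, hsnd] with p h h'
    rw [h, h']

/-- The pseudo-metric `d_□(U,V) = sup_{A,B} |∫_{A×B} (U - V)|`, over all pairs of Lebesgue
measurable sets `A, B ⊆ [0,1]`. -/
def cutNormDist (U V : Graphon) : ℝ :=
  sSup {r : ℝ | ∃ A B : Set I, NullMeasurableSet A volume ∧ NullMeasurableSet B volume ∧
    r = |∫ p in A ×ˢ B, (U.toFun p.1 p.2 - V.toFun p.1 p.2)|}

/-- The cut-distance `δ_□(U,V) = inf_{φ,ψ} d_□(U^φ, V^ψ)`, over all measure-preserving maps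
`φ, ψ : [0,1] → [0,1]`. -/
def cutDist (U V : Graphon) : ℝ :=
  sInf {r : ℝ | ∃ (φ ψ : I → I) (hφ : MeasPres φ volume) (hψ : MeasPres ψ volume),
    r = cutNormDist (U.pullback φ hφ Measure.AbsolutelyContinuous.rfl)
      (V.pullback ψ hψ Measure.AbsolutelyContinuous.rfl)}

/-- Two graphons are weakly isomorphic if their cut-distance is zero. -/
def WeakIso (U V : Graphon) : Prop := cutDist U V = 0

/-- The closure of a set of graphons with respect to the pseudo-metric `δ_□`. -/
def cutClosure (S : Set Graphon) : Set Graphon :=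
  {U | ∀ ε : ℝ, 0 < ε → ∃ V ∈ S, cutDist U V < ε}

/-- A set of graphons is closed with respect to `δ_□` if it contains its `δ_□`-closure. -/
def IsCutClosed (S : Set Graphon) : Prop := cutClosure S ⊆ S

/-- A function on graphons is lower semi-continuous with respect to `δ_□` if each of its
(real) sublevel sets is closed. -/
def CutLowerSemicontinuous (f : Graphon → EReal) : Prop :=
  ∀ ρ : ℝ, IsCutClosed {U | f U ≤ (ρ : EReal)}

/-- Borel probability measures on `[0,1]` absolutely continuous with respect to `λ`. -/
abbrev ACProb : Type :=
  {μ : Measure I // IsProbabilityMeasure μ ∧ μ ≪ volume}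

theorem exists_measPres (μ : ACProb) : ∃ φ : I → I, MeasPres φ μ.1 := by
  have := μ.2.1
  obtain ⟨φ, h, h'⟩ := Measure.exists_measurable_map_eq μ.1
  exact ⟨φ, h.nullMeasurable, h'⟩

/-- A fixed choice of a measure-preserving map `([0,1], λ) → ([0,1], μ)`. -/
def transport (μ : ACProb) : I → I := Classical.choose (exists_measPres μ)

theorem transport_measPres (μ : ACProb) : MeasPres (transport μ) μ.1 :=
  Classical.choose_spec (exists_measPres μ)

/-- The graphon `W_μ(x,y) = W(φ(x), φ(y))`, where `φ : ([0,1], λ) → ([0,1], μ)` is a fixed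
measure-preserving map. -/
def reweight (W : Graphon) (μ : ACProb) : Graphon :=
  W.pullback (transport μ) (transport_measPres μ) μ.2.2

/-- `RN(W)`: the `δ_□`-closure of the set of graphons weakly isomorphic to some `W_μ`. -/
def RN (W : Graphon) : Set Graphon :=
  cutClosure {U | ∃ μ : ACProb, WeakIso U (W.reweight μ)}

/-- The function `x ↦ x log x` on `[0,∞]`, with `0 log 0 = 0` and `∞ log ∞ = ∞`. -/
def xlogx (x : ℝ≥0∞) : EReal :=
  if x = ∞ then ⊤ else ((x.toReal * Real.log x.toReal : ℝ) : EReal)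

/-- The integral `∫_{[0,1]} f dλ` of an extended-real function, as the integral of the positive
part minus the integral of the negative part. -/
def integralEReal (f : I → EReal) : EReal :=
  ((∫⁻ x, (f x).toENNReal : ℝ≥0∞) : EReal) - ((∫⁻ x, (-f x).toENNReal : ℝ≥0∞) : EReal)

/-- The integral `∫_{[0,1]} (dμ/dλ) log (dμ/dλ) dλ`. -/
def entropy (μ : ACProb) : EReal :=
  integralEReal fun x => xlogx (μ.1.rnDeriv volume x)

/-- `K_W(U)`: the infimum of `∫ (dμ/dλ) log (dμ/dλ) dλ` over all Borel probability measures
`μ ≪ λ` with `δ_□(U, W_μ) = 0` (the infimum of the empty set being `∞`). -/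
def K (W U : Graphon) : EReal :=
  sInf {r : EReal | ∃ μ : ACProb, WeakIso U (W.reweight μ) ∧ r = entropy μ}

end Graphon

end

noncomputable section

namespace Graphon

open InformationTheory Filter Topology NNReal ProbabilityTheory

/-! The integral defining $K_W$ is the Kullback–Leibler divergence of $\mu$ from $\lambda$, so every
claim reduces to properties of divergence once convergence of measures is transferred to convergence
of graphons. Non-negativity is then immediate, and invariance under weak isomorphism follows from
the triangle inequality for $\delta_\Box$, proved by gluing measure-preserving maps over a common
law.

The core is a compactness argument. Probability measures on $[0,1]$ are weakly sequentially compact.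
Bounded divergence forces uniform absolute continuity (`unifAC_of_klDiv_le`), so weak limits are
again $\ll\lambda$ (`absolutelyContinuous_of_tendsto`). Divergence is weakly lower semicontinuous by
its duality with $e^g-1$ (`klDiv_le_of_tendsto`). If $\mu_n\to\mu$ weakly and uniformly absolutely
continuously, then $W_{\mu_n}\to W_\mu$ in cut distance along a subsequence
(`exists_subseq_tendsto_cutDist`): quantile functions converge almost everywhere, and $W$ is
replaced by one continuous function that is $L^1$-close under all the laws involved. Together these
give `exists_entropy_le`: the infimum is attained, even along convergent sequences of graphons.
Lower semicontinuity follows, and so does the description of the zero set, since divergence $0$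
forces $\mu=\lambda$.

For density, $\mu$ is conditioned on the set where its density is at most $n$; the resulting
measures have bounded density and approximate $\mu$. For non-constant $W$ the edge density serves as
an invariant: if conditioning $\lambda$ on a set never changed the weak isomorphism class, then
$\int_{A\times A}W=c\,\lambda(A)^2$ for all $A$, and polarisation makes $W$ constant. -/

/-! ### Measure-preserving maps -/

theorem MeasPres.aemeasurable {φ : I → I} {μ : Measure I} (h : MeasPres φ μ) :
    AEMeasurable φ volume :=
  h.nullMeasurable.aemeasurable

theorem measPres_of_measurable {φ : I → I} {μ : Measure I} (h : Measurable φ)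
    (h' : (volume : Measure I).map φ = μ) : MeasPres φ μ :=
  ⟨h.nullMeasurable, h'⟩

theorem MeasPres.id : MeasPres id volume :=
  measPres_of_measurable measurable_id Measure.map_id

theorem MeasPres.comp {φ a : I → I} {μ : Measure I} (hφ : MeasPres φ μ)
    (ha : MeasPres a volume) : MeasPres (φ ∘ a) μ := by
  have h : AEMeasurable φ (volume.map a) := by rw [ha.map_eq]; exact hφ.aemeasurable
  refine ⟨(h.comp_aemeasurable ha.aemeasurable).nullMeasurable, ?_⟩
  rw [← AEMeasurable.map_map_of_aemeasurable h ha.aemeasurable, ha.map_eq, hφ.map_eq]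

theorem MeasPres.comp_ae_eq {φ ψ a b : I → I} (ha : MeasPres a volume)
    (h : φ =ᵐ[volume] ψ) (hab : a =ᵐ[volume] b) :
    φ ∘ a =ᵐ[volume] ψ ∘ b := by
  have h1 : ∀ᵐ x ∂(volume.map a), φ x = ψ x := by rw [ha.map_eq]; exact h
  filter_upwards [ae_of_ae_map ha.aemeasurable h1, hab] with x hx hx'
  simp only [Function.comp_apply, hx, ← hx']

/-! ### The cut norm -/

/-- The difference of two graphons as a function on the square. -/
def diff (U V : Graphon) (p : I × I) : ℝ := U.toFun p.1 p.2 - V.toFun p.1 p.2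

theorem aestronglyMeasurable (U : Graphon) :
    AEStronglyMeasurable (fun p : I × I => U.toFun p.1 p.2) volume :=
  U.measurable.aemeasurable.aestronglyMeasurable

theorem aestronglyMeasurable_diff (U V : Graphon) :
    AEStronglyMeasurable (diff U V) volume :=
  U.aestronglyMeasurable.sub V.aestronglyMeasurable

theorem abs_sub_le_one {a b : ℝ} (ha : 0 ≤ a) (ha' : a ≤ 1) (hb : 0 ≤ b) (hb' : b ≤ 1) :
    |a - b| ≤ 1 :=
  abs_le.2 ⟨by linarith, by linarith⟩

theorem abs_diff_le_one (U V : Graphon) (p : I × I) : |diff U V p| ≤ 1 :=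
  abs_sub_le_one (U.nonneg _ _) (U.le_one _ _) (V.nonneg _ _) (V.le_one _ _)

theorem integrable_diff (U V : Graphon) {ν : Measure (I × I)} [IsFiniteMeasure ν]
    (h : ν ≪ volume) : Integrable (diff U V) ν :=
  Integrable.of_bound ((aestronglyMeasurable_diff U V).mono_ac h) 1
    (Filter.Eventually.of_forall fun p => by simpa using abs_diff_le_one U V p)

theorem abs_setIntegral_diff_le_one (U V : Graphon) (S : Set (I × I)) :
    |∫ p in S, diff U V p| ≤ 1 := by
  have h := norm_integral_le_of_norm_le_const (μ := volume.restrict S) (f := diff U V) (C := 1)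
    (Filter.Eventually.of_forall fun p => by simpa using abs_diff_le_one U V p)
  rw [Real.norm_eq_abs] at h
  refine h.trans ?_
  rw [one_mul]
  refine ENNReal.toReal_le_of_le_ofReal zero_le_one ?_
  simpa using prob_le_one (μ := (volume : Measure (I × I))) (s := S)

theorem abs_setIntegral_le_cutNormDist (U V : Graphon) {A B : Set I}
    (hA : NullMeasurableSet A volume) (hB : NullMeasurableSet B volume) :
    |∫ p in A ×ˢ B, diff U V p| ≤ cutNormDist U V := by
  refine le_csSup ⟨1, ?_⟩ ⟨A, B, hA, hB, rfl⟩
  rintro r ⟨A, B, -, -, rfl⟩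
  exact abs_setIntegral_diff_le_one U V _

theorem cutNormDist_le {U V : Graphon} {c : ℝ}
    (h : ∀ A B : Set I, NullMeasurableSet A volume → NullMeasurableSet B volume →
      |∫ p in A ×ˢ B, diff U V p| ≤ c) : cutNormDist U V ≤ c := by
  refine csSup_le ⟨_, ∅, ∅, nullMeasurableSet_empty, nullMeasurableSet_empty, rfl⟩ ?_
  rintro r ⟨A, B, hA, hB, rfl⟩
  exact h A B hA hB

theorem cutNormDist_nonneg (U V : Graphon) : 0 ≤ cutNormDist U V :=
  (abs_nonneg _).trans
    (abs_setIntegral_le_cutNormDist U V nullMeasurableSet_empty nullMeasurableSet_empty)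

theorem cutNormDist_comm (U V : Graphon) : cutNormDist U V = cutNormDist V U := by
  have key : ∀ U V : Graphon, cutNormDist U V ≤ cutNormDist V U := fun U V => by
    refine cutNormDist_le fun A B hA hB => ?_
    refine le_trans (le_of_eq ?_) (abs_setIntegral_le_cutNormDist V U hA hB)
    rw [← abs_neg, ← integral_neg]
    simp only [diff, neg_sub]
  exact le_antisymm (key U V) (key V U)

theorem cutNormDist_le_integral (U V : Graphon) :
    cutNormDist U V ≤ ∫ p, |diff U V p| := by
  refine cutNormDist_le fun A B _ _ => ?_
  refine (abs_integral_le_integral_abs).trans ?_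
  exact setIntegral_le_integral (integrable_diff U V Measure.AbsolutelyContinuous.rfl).abs
    (Filter.Eventually.of_forall fun p => abs_nonneg _)

theorem cutNormDist_triangle (U V W : Graphon) :
    cutNormDist U W ≤ cutNormDist U V + cutNormDist V W := by
  refine cutNormDist_le fun A B hA hB => ?_
  have h : ∫ p in A ×ˢ B, diff U W p
      = (∫ p in A ×ˢ B, diff U V p) + ∫ p in A ×ˢ B, diff V W p := by
    rw [← integral_add (integrable_diff U V Measure.restrict_le_self.absolutelyContinuous)
      (integrable_diff V W Measure.restrict_le_self.absolutelyContinuous)]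
    simp only [diff, sub_add_sub_cancel]
  rw [h]
  exact (abs_add_le _ _).trans (add_le_add (abs_setIntegral_le_cutNormDist U V hA hB)
    (abs_setIntegral_le_cutNormDist V W hA hB))

theorem cutNormDist_congr {U V U' V' : Graphon}
    (hU : (fun p : I × I => U.toFun p.1 p.2) =ᵐ[volume] fun p => U'.toFun p.1 p.2)
    (hV : (fun p : I × I => V.toFun p.1 p.2) =ᵐ[volume] fun p => V'.toFun p.1 p.2) :
    cutNormDist U V = cutNormDist U' V' := by
  have key : ∀ A B : Set I, ∫ p in A ×ˢ B, diff U V p = ∫ p in A ×ˢ B, diff U' V' p :=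
    fun A B => integral_congr_ae (ae_restrict_of_ae (hU.sub hV))
  refine le_antisymm (cutNormDist_le fun A B hA hB => ?_) (cutNormDist_le fun A B hA hB => ?_)
  · rw [key]; exact abs_setIntegral_le_cutNormDist _ _ hA hB
  · rw [← key]; exact abs_setIntegral_le_cutNormDist _ _ hA hB

/-- Since $\alpha\le\lambda$ has density in $[0,1]$, the integral is largest when that density is
the indicator of $\{h\ge 0\}$. -/
theorem exists_integral_le_setIntegral {h : I → ℝ} (hh : Integrable h volume) {α : Measure I}
    (hα : α ≤ volume) :
    ∃ A : Set I, NullMeasurableSet A volume ∧ ∫ x, h x ∂α ≤ ∫ x in A, h x := by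
  have hA : NullMeasurableSet {x | 0 ≤ h x} volume :=
    nullMeasurableSet_le aemeasurable_const hh.aemeasurable
  refine ⟨{x | 0 ≤ h x}, hA, ?_⟩
  have hpos : Integrable (fun x => max (h x) 0) volume := hh.pos_part
  calc ∫ x, h x ∂α ≤ ∫ x, max (h x) 0 ∂α :=
        integral_mono (hh.mono_measure hα) (hpos.mono_measure hα) fun x => le_max_left _ _
    _ ≤ ∫ x, max (h x) 0 :=
        integral_mono_measure hα (Filter.Eventually.of_forall fun x => le_max_right _ _) hpos
    _ = ∫ x in {x | 0 ≤ h x}, h x := by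
        rw [← integral_indicator₀ hA]
        refine integral_congr_ae (Filter.Eventually.of_forall fun x => ?_)
        by_cases hx : 0 ≤ h x
        · simp [hx]
        · simp [hx, (not_le.1 hx).le]

/-- The integral is linear in each of $\alpha$ and $\beta$ separately, so each can be replaced in
turn by the restriction of $\lambda$ to a set. -/
theorem exists_integral_prod_le_setIntegral {D : I × I → ℝ} (hD : Integrable D volume)
    {α β : Measure I} (hα : α ≤ volume) (hβ : β ≤ volume) :
    ∃ A B : Set I, NullMeasurableSet A volume ∧ NullMeasurableSet B volume ∧
      ∫ p, D p ∂(α.prod β) ≤ ∫ p in A ×ˢ B, D p := by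
  have : IsFiniteMeasure α := isFiniteMeasure_of_le _ hα
  have : IsFiniteMeasure β := isFiniteMeasure_of_le _ hβ
  have hD1 : Integrable D ((volume : Measure I).prod β) :=
    hD.mono_measure (Measure.prod_mono le_rfl hβ)
  have hDαβ : Integrable D (α.prod β) := hD.mono_measure (Measure.prod_mono hα hβ)
  obtain ⟨A, hA, h1⟩ := exists_integral_le_setIntegral hD1.integral_prod_left hα
  have hD2 : Integrable D ((volume.restrict A).prod volume) :=
    hD.mono_measure (Measure.prod_mono Measure.restrict_le_self le_rfl)
  obtain ⟨B, hB, h2⟩ := exists_integral_le_setIntegral hD2.integral_prod_right hβ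
  refine ⟨A, B, hA, hB, ?_⟩
  rw [integral_prod _ hDαβ]
  refine h1.trans ?_
  have hD3 : Integrable D ((volume.restrict A).prod β) :=
    hD.mono_measure (Measure.prod_mono Measure.restrict_le_self hβ)
  have hD4 : Integrable D ((volume.restrict A).prod (volume.restrict B)) :=
    hD.mono_measure (Measure.prod_mono Measure.restrict_le_self Measure.restrict_le_self)
  rw [← integral_prod _ hD3, integral_prod_symm _ hD3]
  refine h2.trans ?_
  rw [← integral_prod_symm _ hD4, Measure.prod_restrict, Measure.volume_eq_prod]

theorem abs_integral_prod_le_cutNormDist (U V : Graphon) {α β : Measure I}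
    (hα : α ≤ volume) (hβ : β ≤ volume) :
    |∫ p, diff U V p ∂(α.prod β)| ≤ cutNormDist U V := by
  have hD : Integrable (diff U V) volume := integrable_diff U V Measure.AbsolutelyContinuous.rfl
  obtain ⟨A, B, hA, hB, h⟩ := exists_integral_prod_le_setIntegral hD hα hβ
  obtain ⟨A', B', hA', hB', h'⟩ := exists_integral_prod_le_setIntegral hD.neg hα hβ
  have h1 := abs_le.1 (abs_setIntegral_le_cutNormDist U V hA hB)
  have h2 := abs_le.1 (abs_setIntegral_le_cutNormDist U V hA' hB')
  simp only [Pi.neg_apply, integral_neg] at h'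
  rw [abs_le]
  constructor <;> linarith

/-- The pull-back along a measure-preserving map of `([0,1], λ)`. -/
abbrev pull (U : Graphon) {a : I → I} (ha : MeasPres a volume) : Graphon :=
  U.pullback a ha Measure.AbsolutelyContinuous.rfl

theorem MeasPres.congr {φ ψ : I → I} {μ : Measure I} (hφ : MeasPres φ μ)
    (h : φ =ᵐ[volume] ψ) : MeasPres ψ μ :=
  ⟨(hφ.aemeasurable.congr h).nullMeasurable, by rw [← Measure.map_congr h, hφ.map_eq]⟩

theorem toFun_comp_ae_eq (W : Graphon) {φ ψ : I → I} (h : φ =ᵐ[volume] ψ) :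
    (fun p : I × I => W.toFun (φ p.1) (φ p.2)) =ᵐ[volume]
      fun p => W.toFun (ψ p.1) (ψ p.2) := by
  have hfst : ∀ᵐ p : I × I, φ p.1 = ψ p.1 := Measure.quasiMeasurePreserving_fst.ae h
  have hsnd : ∀ᵐ p : I × I, φ p.2 = ψ p.2 := Measure.quasiMeasurePreserving_snd.ae h
  filter_upwards [hfst, hsnd] with p h1 h2
  rw [h1, h2]

/-- Testing a pull-back on $A\times B$ amounts to testing the original against the push-forwards of
$\lambda|_A$ and $\lambda|_B$. These are dominated by $\lambda$, though they need not be
restrictions of it. -/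
theorem cutNormDist_pull_le (U V : Graphon) {a : I → I} (ha : MeasPres a volume) :
    cutNormDist (U.pull ha) (V.pull ha) ≤ cutNormDist U V := by
  obtain ⟨b, hb, hab⟩ := ha.aemeasurable
  have hb' := ha.congr hab
  refine cutNormDist_le fun A B hA hB => ?_
  have hle : ∀ S : Set I, (volume.restrict S).map b ≤ volume := fun S => by
    conv_rhs => rw [← hb'.map_eq]
    exact Measure.map_mono Measure.restrict_le_self hb
  have hfin : ∀ S : Set I, IsFiniteMeasure ((volume.restrict S).map b) := fun S =>
    isFiniteMeasure_of_le _ (hle S)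
  have := hfin A
  have := hfin B
  have key : ∫ p in A ×ˢ B, diff (U.pull ha) (V.pull ha) p
      = ∫ p, diff U V p ∂(((volume.restrict A).map b).prod ((volume.restrict B).map b)) := by
    rw [Measure.map_prod_map _ _ hb hb, integral_map (hb.prodMap hb).aemeasurable]
    · rw [Measure.prod_restrict, ← Measure.volume_eq_prod]
      refine integral_congr_ae (ae_restrict_of_ae ?_)
      have hfst : ∀ᵐ p : I × I, a p.1 = b p.1 := Measure.quasiMeasurePreserving_fst.ae hab
      have hsnd : ∀ᵐ p : I × I, a p.2 = b p.2 := Measure.quasiMeasurePreserving_snd.ae hab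
      filter_upwards [hfst, hsnd] with p h1 h2
      simp only [diff, pull, pullback, Prod.map, h1, h2]
    · rw [← Measure.map_prod_map _ _ hb hb]
      exact (aestronglyMeasurable_diff U V).mono_ac
        (Measure.prod_mono (hle A) (hle B)).absolutelyContinuous
  rw [key]
  exact abs_integral_prod_le_cutNormDist U V (hle A) (hle B)

/-! ### Couplings and the cut distance -/

theorem exists_comp_ae_eq_of_measurable {φ ψ : I → I} (hφ : Measurable φ) (hψ : Measurable ψ)
    (h : (volume : Measure I).map φ = volume.map ψ) :
    ∃ a b : I → I, MeasPres a volume ∧ MeasPres b volume ∧ φ ∘ a =ᵐ[volume] ψ ∘ b := by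
  set μ := (volume : Measure I).map φ with hμ
  have : IsProbabilityMeasure μ := Measure.isProbabilityMeasure_map hφ.aemeasurable
  let κ := condDistrib id φ (volume : Measure I)
  let η := condDistrib id ψ (volume : Measure I)
  -- Draw the common value from $\mu$, then independent points of the two fibres over it. Both fibre
  -- points are $\lambda$-distributed, and $\varphi$ and $\psi$ agree on them.
  let Z := μ ⊗ₘ (κ ×ₖ η)
  have h1 : Z.map (Prod.map id Prod.fst) = volume.map fun x => (φ x, x) := by
    rw [← Measure.compProd_map measurable_fst, ← Kernel.fst_eq, Kernel.fst_prod,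
      compProd_map_condDistrib aemeasurable_id]
    rfl
  have h2 : Z.map (Prod.map id Prod.snd) = volume.map fun x => (ψ x, x) := by
    rw [← Measure.compProd_map measurable_snd, ← Kernel.snd_eq, Kernel.snd_prod, h,
      compProd_map_condDistrib aemeasurable_id]
    rfl
  have hsupp : ∀ {f : I → I}, Measurable f →
      ∀ᵐ q ∂((volume : Measure I).map fun x => (f x, x)), q.1 = f q.2 := fun {f} hf => by
    have hS : MeasurableSet {q : I × I | q.1 = f q.2} :=
      measurableSet_eq_fun measurable_fst (hf.comp measurable_snd)
    exact (ae_map_iff (by fun_prop) hS).2 (Filter.Eventually.of_forall fun x => rfl)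
  have hm1 : Measurable (Prod.map id Prod.fst : I × I × I → I × I) := by fun_prop
  have hm2 : Measurable (Prod.map id Prod.snd : I × I × I → I × I) := by fun_prop
  have hZ1 : ∀ᵐ z ∂Z, z.1 = φ z.2.1 :=
    ae_of_ae_map (p := fun q => q.1 = φ q.2) hm1.aemeasurable (by rw [h1]; exact hsupp hφ)
  have hZ2 : ∀ᵐ z ∂Z, z.1 = ψ z.2.2 :=
    ae_of_ae_map (p := fun q => q.1 = ψ q.2) hm2.aemeasurable (by rw [h2]; exact hsupp hψ)
  have : IsProbabilityMeasure (Z.map Prod.snd) :=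
    Measure.isProbabilityMeasure_map measurable_snd.aemeasurable
  -- Realising the law of the pair of fibre points as an image of $\lambda$ turns the coupling into
  -- two maps.
  obtain ⟨f, hf, hfZ⟩ := Measure.exists_measurable_map_eq (Z.map Prod.snd)
  refine ⟨Prod.fst ∘ f, Prod.snd ∘ f, measPres_of_measurable (measurable_fst.comp hf) ?_,
    measPres_of_measurable (measurable_snd.comp hf) ?_, ?_⟩
  · rw [← Measure.map_map measurable_fst hf, hfZ, Measure.map_map measurable_fst measurable_snd]
    have : (Prod.fst ∘ Prod.snd : I × I × I → I) = Prod.snd ∘ Prod.map id Prod.fst := rfl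
    rw [this, ← Measure.map_map measurable_snd hm1, h1,
      Measure.map_map measurable_snd (by fun_prop)]
    exact Measure.map_id
  · rw [← Measure.map_map measurable_snd hf, hfZ, Measure.map_map measurable_snd measurable_snd]
    have : (Prod.snd ∘ Prod.snd : I × I × I → I) = Prod.snd ∘ Prod.map id Prod.snd := rfl
    rw [this, ← Measure.map_map measurable_snd hm2, h2,
      Measure.map_map measurable_snd (by fun_prop)]
    exact Measure.map_id
  · have hS : MeasurableSet {q : I × I | φ q.1 = ψ q.2} :=
      measurableSet_eq_fun (hφ.comp measurable_fst) (hψ.comp measurable_snd)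
    refine ae_of_ae_map (p := fun q : I × I => φ q.1 = ψ q.2) hf.aemeasurable ?_
    rw [hfZ, ae_map_iff measurable_snd.aemeasurable hS]
    filter_upwards [hZ1, hZ2] with z hz1 hz2
    rw [← hz1, ← hz2]

/-- Two maps of the same law agree almost everywhere after composition with suitable
measure-preserving maps. -/
theorem exists_comp_ae_eq {φ ψ : I → I} {μ : Measure I} (hφ : MeasPres φ μ)
    (hψ : MeasPres ψ μ) :
    ∃ a b : I → I, MeasPres a volume ∧ MeasPres b volume ∧ φ ∘ a =ᵐ[volume] ψ ∘ b := by
  obtain ⟨φ', hm, h⟩ := hφ.aemeasurable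
  obtain ⟨ψ', hm', h'⟩ := hψ.aemeasurable
  obtain ⟨a, b, ha, hb, hab⟩ := exists_comp_ae_eq_of_measurable hm hm'
    ((hφ.congr h).map_eq.trans (hψ.congr h').map_eq.symm)
  exact ⟨a, b, ha, hb, (ha.comp_ae_eq h Filter.EventuallyEq.rfl).trans
    (hab.trans (hb.comp_ae_eq h' Filter.EventuallyEq.rfl).symm)⟩

theorem cutDist_le (U V : Graphon) {φ ψ : I → I} (hφ : MeasPres φ volume)
    (hψ : MeasPres ψ volume) : cutDist U V ≤ cutNormDist (U.pull hφ) (V.pull hψ) := by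
  refine csInf_le ⟨0, ?_⟩ ⟨φ, ψ, hφ, hψ, rfl⟩
  rintro r ⟨φ, ψ, hφ, hψ, rfl⟩
  exact cutNormDist_nonneg _ _

theorem exists_of_cutDist_lt {U V : Graphon} {r : ℝ} (h : cutDist U V < r) :
    ∃ (φ ψ : I → I) (hφ : MeasPres φ volume) (hψ : MeasPres ψ volume),
      cutNormDist (U.pull hφ) (V.pull hψ) < r := by
  rw [cutDist] at h
  obtain ⟨_, ⟨φ, ψ, hφ, hψ, rfl⟩, hr⟩ :=
    exists_lt_of_csInf_lt (by exact ⟨_, id, id, MeasPres.id, MeasPres.id, rfl⟩) h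
  exact ⟨φ, ψ, hφ, hψ, hr⟩

theorem cutDist_nonneg (U V : Graphon) : 0 ≤ cutDist U V := by
  refine le_csInf ⟨_, id, id, MeasPres.id, MeasPres.id, rfl⟩ ?_
  rintro r ⟨φ, ψ, hφ, hψ, rfl⟩
  exact cutNormDist_nonneg _ _

theorem cutDist_comm (U V : Graphon) : cutDist U V = cutDist V U := by
  have key : ∀ U V : Graphon, cutDist U V ≤ cutDist V U := fun U V =>
    le_of_forall_gt fun r hr => by
      obtain ⟨φ, ψ, hφ, hψ, h⟩ := exists_of_cutDist_lt hr
      exact (cutDist_le U V hψ hφ).trans_lt (by rwa [cutNormDist_comm])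
  exact le_antisymm (key U V) (key V U)

theorem cutDist_triangle (U V W : Graphon) : cutDist U W ≤ cutDist U V + cutDist V W := by
  refine le_of_forall_pos_lt_add fun ε hε => ?_
  obtain ⟨φ, ψ, hφ, hψ, h⟩ :=
    exists_of_cutDist_lt (show cutDist U V < cutDist U V + ε / 2 by linarith)
  obtain ⟨φ', ψ', hφ', hψ', h'⟩ :=
    exists_of_cutDist_lt (show cutDist V W < cutDist V W + ε / 2 by linarith)
  -- The two near-optimal choices pull $V$ back along different maps; composing further makes these
  -- agree, and composition does not increase cut norms.
  obtain ⟨a, b, ha, hb, hab⟩ := exists_comp_ae_eq hψ hφ'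
  have h1 := cutDist_le U W (hφ.comp ha) (hψ'.comp hb)
  have h2 := cutNormDist_triangle (U.pull (hφ.comp ha)) (V.pull (hψ.comp ha))
    (W.pull (hψ'.comp hb))
  have h3 : cutNormDist (U.pull (hφ.comp ha)) (V.pull (hψ.comp ha))
      ≤ cutNormDist (U.pull hφ) (V.pull hψ) :=
    cutNormDist_pull_le (U.pull hφ) (V.pull hψ) ha
  have h4 : cutNormDist (V.pull (hψ.comp ha)) (W.pull (hψ'.comp hb))
      = cutNormDist ((V.pull hφ').pull hb) ((W.pull hψ').pull hb) :=
    cutNormDist_congr (V.toFun_comp_ae_eq hab) Filter.EventuallyEq.rfl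
  have h5 := cutNormDist_pull_le (V.pull hφ') (W.pull hψ') hb
  linarith

theorem cutNormDist_eq_zero {U V : Graphon}
    (h : (fun p : I × I => U.toFun p.1 p.2) =ᵐ[volume] fun p => V.toFun p.1 p.2) :
    cutNormDist U V = 0 := by
  refine le_antisymm (cutNormDist_le fun A B _ _ => ?_) (cutNormDist_nonneg U V)
  have h0 : ∫ p in A ×ˢ B, diff U V p = ∫ p in A ×ˢ B, (0 : ℝ) := by
    refine integral_congr_ae (ae_restrict_of_ae ?_)
    filter_upwards [h] with p hp
    rw [diff, hp, sub_self]
  simp [h0]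

theorem cutDist_self (U : Graphon) : cutDist U U = 0 :=
  le_antisymm ((cutDist_le U U MeasPres.id MeasPres.id).trans
    (cutNormDist_eq_zero Filter.EventuallyEq.rfl).le) (cutDist_nonneg U U)

theorem WeakIso.symm {U V : Graphon} (h : WeakIso U V) : WeakIso V U :=
  (cutDist_comm V U).trans h

theorem WeakIso.trans {U V W : Graphon} (h : WeakIso U V) (h' : WeakIso V W) : WeakIso U W := by
  refine le_antisymm ?_ (cutDist_nonneg U W)
  have := cutDist_triangle U V W
  rw [WeakIso] at h h'
  linarith

theorem cutDist_le_cutNormDist (U V : Graphon) : cutDist U V ≤ cutNormDist U V :=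
  cutDist_le U V MeasPres.id MeasPres.id

/-- Pull-backs of `W` along maps of the same law are weakly isomorphic. -/
theorem weakIso_pullback (W : Graphon) {φ ψ : I → I} {μ : Measure I} (hφ : MeasPres φ μ)
    (hψ : MeasPres ψ μ) (hμ : μ ≪ volume) :
    WeakIso (W.pullback φ hφ hμ) (W.pullback ψ hψ hμ) := by
  obtain ⟨a, b, ha, hb, hab⟩ := exists_comp_ae_eq hφ hψ
  exact le_antisymm ((cutDist_le _ _ ha hb).trans
    (cutNormDist_eq_zero (W.toFun_comp_ae_eq hab)).le) (cutDist_nonneg _ _)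

theorem cutDist_reweight_le (W : Graphon) (μ ν : ACProb) {φ ψ : I → I} (hφ : MeasPres φ μ.1)
    (hψ : MeasPres ψ ν.1) :
    cutDist (W.reweight μ) (W.reweight ν) ≤
      cutNormDist (W.pullback φ hφ μ.2.2) (W.pullback ψ hψ ν.2.2) := by
  have h1 := cutDist_triangle (W.reweight μ) (W.pullback φ hφ μ.2.2) (W.reweight ν)
  have h2 := cutDist_triangle (W.pullback φ hφ μ.2.2) (W.pullback ψ hψ ν.2.2) (W.reweight ν)
  have h3 : cutDist (W.reweight μ) (W.pullback φ hφ μ.2.2) = 0 :=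
    W.weakIso_pullback (transport_measPres μ) hφ μ.2.2
  have h4 : cutDist (W.pullback ψ hψ ν.2.2) (W.reweight ν) = 0 :=
    W.weakIso_pullback hψ (transport_measPres ν) ν.2.2
  have h5 := cutDist_le_cutNormDist (W.pullback φ hφ μ.2.2) (W.pullback ψ hψ ν.2.2)
  linarith

/-- Lebesgue measure as an element of `ACProb`. -/
def acVolume : ACProb := ⟨volume, inferInstance, Measure.AbsolutelyContinuous.rfl⟩

theorem weakIso_reweight_acVolume (W : Graphon) : WeakIso W (W.reweight acVolume) :=
  W.weakIso_pullback MeasPres.id (transport_measPres acVolume) Measure.AbsolutelyContinuous.rfl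

theorem K_congr (W : Graphon) {U V : Graphon} (h : WeakIso U V) : K W U = K W V := by
  have : ∀ μ : ACProb, WeakIso U (W.reweight μ) ↔ WeakIso V (W.reweight μ) := fun μ =>
    ⟨h.symm.trans, h.trans⟩
  simp only [K, this]

/-! ### Entropy as Kullback–Leibler divergence -/

theorem ACProb.isProbabilityMeasure (μ : ACProb) : IsProbabilityMeasure μ.1 := μ.2.1

theorem neg_mul_log_le_one {y : ℝ} (hy : 0 ≤ y) : -(y * Real.log y) ≤ 1 := by
  have := klFun_nonneg hy
  rw [klFun_apply] at this
  linarith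

/-- The entropy is the Kullback-Leibler divergence from Lebesgue measure. -/
theorem entropy_eq_klDiv (μ : ACProb) : entropy μ = (klDiv μ.1 volume : ℝ≥0∞) := by
  have := μ.isProbabilityMeasure
  set f : I → ℝ≥0∞ := μ.1.rnDeriv volume with hf
  have hfm : Measurable f := Measure.measurable_rnDeriv _ _
  have hlog : Measurable fun x => (f x).toReal * Real.log (f x).toReal :=
    hfm.ennreal_toReal.mul (Real.measurable_log.comp hfm.ennreal_toReal)
  have hfin : ∀ᵐ x, f x < ∞ := Measure.rnDeriv_lt_top _ _
  have hP : ∫⁻ x, (xlogx (f x)).toENNReal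
      = ∫⁻ x, ENNReal.ofReal ((f x).toReal * Real.log (f x).toReal) := by
    refine lintegral_congr_ae ?_
    filter_upwards [hfin] with x hx
    rw [xlogx, if_neg hx.ne, EReal.toENNReal_of_ne_top (EReal.coe_ne_top _), EReal.toReal_coe]
  have hN : ∫⁻ x, (-xlogx (f x)).toENNReal
      = ∫⁻ x, ENNReal.ofReal (-((f x).toReal * Real.log (f x).toReal)) := by
    refine lintegral_congr_ae ?_
    filter_upwards [hfin] with x hx
    rw [xlogx, if_neg hx.ne, ← EReal.coe_neg, EReal.toENNReal_of_ne_top (EReal.coe_ne_top _),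
      EReal.toReal_coe]
  -- Finiteness of the negative part is what makes the subtraction in `EReal` cancel at the end.
  have hNle : ∫⁻ x, ENNReal.ofReal (-((f x).toReal * Real.log (f x).toReal)) ≤ 1 := by
    calc _ ≤ ∫⁻ _ : I, 1 := lintegral_mono fun x => by
            rw [← ENNReal.ofReal_one]
            exact ENNReal.ofReal_le_ofReal (neg_mul_log_le_one ENNReal.toReal_nonneg)
      _ = 1 := by simp
  have hone : ∫⁻ x, f x = 1 := by
    rw [hf, Measure.lintegral_rnDeriv μ.2.2, measure_univ]
  have hsum : klDiv μ.1 volume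
        + ∫⁻ x, ENNReal.ofReal (-((f x).toReal * Real.log (f x).toReal))
      = ∫⁻ x, ENNReal.ofReal ((f x).toReal * Real.log (f x).toReal) := by
    rw [klDiv_eq_lintegral_klFun_of_ac μ.2.2]
    have hk : Measurable fun x => ENNReal.ofReal (klFun (f x).toReal) :=
      (measurable_klFun.comp hfm.ennreal_toReal).ennreal_ofReal
    -- Adding $1=\int f$ to both sides reduces the claim to the pointwise identity
    -- $\mathrm{klFun}(y)+(y\log y)^-+y=(y\log y)^++1$.
    refine (ENNReal.add_left_inj ENNReal.one_ne_top).1 ?_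
    calc _ = ∫⁻ x, (ENNReal.ofReal (klFun (f x).toReal)
            + ENNReal.ofReal (-((f x).toReal * Real.log (f x).toReal)) + f x) := by
          rw [lintegral_add_right _ hfm, lintegral_add_left hk, hone]
      _ = ∫⁻ x, (ENNReal.ofReal ((f x).toReal * Real.log (f x).toReal) + 1) := by
          refine lintegral_congr_ae ?_
          filter_upwards [hfin] with x hx
          conv_lhs => rw [← ENNReal.ofReal_toReal hx.ne]
          have h0 : 0 ≤ (f x).toReal := ENNReal.toReal_nonneg
          rw [ENNReal.toReal_ofReal h0]
          generalize (f x).toReal = y at h0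
          have hk0 := klFun_nonneg h0
          rcases le_total 0 (y * Real.log y) with hy | hy
          · rw [ENNReal.ofReal_of_nonpos (neg_nonpos.2 hy), add_zero,
              ← ENNReal.ofReal_add hk0 h0, ← ENNReal.ofReal_one, ← ENNReal.ofReal_add hy
              zero_le_one, klFun_apply]
            congr 1; ring
          · rw [ENNReal.ofReal_of_nonpos hy, zero_add,
              ← ENNReal.ofReal_add hk0 (neg_nonneg.2 hy),
              ← ENNReal.ofReal_add (add_nonneg hk0 (neg_nonneg.2 hy)) h0, ← ENNReal.ofReal_one,
              klFun_apply]
            congr 1; ring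
      _ = _ := by rw [lintegral_add_left hlog.ennreal_ofReal]; simp
  rw [entropy, integralEReal, hP, hN, ← hsum, EReal.coe_ennreal_add]
  rw [← ENNReal.ofReal_toReal (hNle.trans_lt ENNReal.one_lt_top).ne,
    EReal.coe_ennreal_ofReal]
  exact EReal.add_sub_cancel_right

/-- Young's inequality: $e^g-1$ is the convex conjugate of `klFun`. It drives both uniform absolute
continuity and lower semicontinuity. -/
theorem mul_le_klFun_add {y : ℝ} (hy : 0 ≤ y) (g : ℝ) :
    y * g ≤ klFun y + (Real.exp g - 1) := by
  rw [klFun_apply]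
  rcases hy.eq_or_lt with rfl | hy
  · simp [Real.exp_nonneg]
  · have h := Real.add_one_le_exp (g - Real.log y)
    rw [Real.exp_sub, Real.exp_log hy, le_div_iff₀ hy] at h
    linarith

/-! ### Uniform absolute continuity -/

/-- Uniform absolute continuity with respect to Lebesgue measure of a set of measures. -/
def UnifAC (S : Set (Measure I)) : Prop :=
  ∀ ε : ℝ, 0 < ε → ∃ R : ℝ≥0, ∀ μ ∈ S, ∀ h : I → ℝ≥0∞, Measurable h → (∀ x, h x ≤ 1) →
    ∫⁻ x, h x ∂μ ≤ ENNReal.ofReal ε + R * ∫⁻ x, h x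

theorem UnifAC.mono {S T : Set (Measure I)} (hS : UnifAC S) (h : T ⊆ S) : UnifAC T :=
  fun ε hε => by
    obtain ⟨R, hR⟩ := hS ε hε
    exact ⟨R, fun μ hμ => hR μ (h hμ)⟩

theorem mul_lintegral_le_klDiv_add {μ : Measure I} [IsFiniteMeasure μ] (hμ : μ ≪ volume) {t : ℝ}
    (ht : 0 ≤ t) {h : I → ℝ≥0∞} (hm : Measurable h) (h1 : ∀ x, h x ≤ 1) :
    ENNReal.ofReal t * ∫⁻ x, h x ∂μ
      ≤ klDiv μ volume + ENNReal.ofReal (Real.exp t - 1) * ∫⁻ x, h x := by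
  set f : I → ℝ≥0∞ := μ.rnDeriv volume with hf
  have hfm : Measurable f := Measure.measurable_rnDeriv _ _
  have hk : Measurable fun x => ENNReal.ofReal (klFun (f x).toReal) :=
    (measurable_klFun.comp hfm.ennreal_toReal).ennreal_ofReal
  rw [klDiv_eq_lintegral_klFun_of_ac hμ, ← lintegral_rnDeriv_mul hμ hm.aemeasurable,
    ← lintegral_const_mul _ hm,
    ← lintegral_const_mul (f := fun x => μ.rnDeriv volume x * h x) _ (hfm.mul hm),
    ← lintegral_add_left hk]
  refine lintegral_mono_ae ?_
  filter_upwards [Measure.rnDeriv_lt_top μ volume] with x hx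
  have hx' : μ.rnDeriv volume x = ENNReal.ofReal (f x).toReal :=
    (ENNReal.ofReal_toReal hx.ne).symm
  have hy : 0 ≤ (f x).toReal := ENNReal.toReal_nonneg
  have hh : h x = ENNReal.ofReal (h x).toReal :=
    (ENNReal.ofReal_toReal ((h1 x).trans_lt ENNReal.one_lt_top).ne).symm
  have hs0 : 0 ≤ (h x).toReal := ENNReal.toReal_nonneg
  have hs1 : (h x).toReal ≤ 1 := ENNReal.toReal_le_of_le_ofReal zero_le_one (by simpa using h1 x)
  have het : 0 ≤ Real.exp t - 1 := by linarith [Real.one_le_exp ht]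
  rw [hx', hh]
  generalize (f x).toReal = y at hy
  generalize (h x).toReal = s at hs0 hs1
  rw [← ENNReal.ofReal_mul hy, ← ENNReal.ofReal_mul ht, ← ENNReal.ofReal_mul het,
    ← ENNReal.ofReal_add (klFun_nonneg hy) (mul_nonneg het hs0)]
  refine ENNReal.ofReal_le_ofReal ?_
  -- Young's inequality at $st$, followed by the chord bound $e^{st}-1\le s(e^t-1)$ for $s\in[0,1]$.
  have h2 := mul_le_klFun_add hy (s * t)
  have h3 := convexOn_exp.2 (mem_univ (0 : ℝ)) (mem_univ t) (sub_nonneg.2 hs1) hs0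
    (sub_add_cancel 1 s)
  simp only [smul_eq_mul, mul_zero, zero_add, Real.exp_zero, mul_one] at h3
  linarith

theorem unifAC_of_klDiv_le {C : ℝ≥0∞} (hC : C ≠ ∞) :
    UnifAC {μ | IsProbabilityMeasure μ ∧ μ ≪ volume ∧ klDiv μ volume ≤ C} := by
  intro ε hε
  have hc0 : 0 ≤ C.toReal := ENNReal.toReal_nonneg
  -- Dividing the previous estimate by $t$ must bring the entropy term below $\varepsilon$; the $+1$
  -- keeps $t$ positive when $C=0$.
  set t : ℝ := (C.toReal + 1) / ε with ht
  have ht0 : 0 < t := by positivity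
  refine ⟨Real.toNNReal ((Real.exp t - 1) / t), fun μ ⟨hp, hac, hle⟩ h hm h1 => ?_⟩
  have key := (mul_lintegral_le_klDiv_add hac ht0.le hm h1).trans (add_le_add_left hle _)
  have key2 := mul_le_mul_right key (ENNReal.ofReal t⁻¹)
  have hinv : 0 ≤ t⁻¹ := inv_nonneg.2 ht0.le
  rw [← mul_assoc, ← ENNReal.ofReal_mul hinv, inv_mul_cancel₀ ht0.ne', ENNReal.ofReal_one,
    one_mul, mul_add, ← mul_assoc, ← ENNReal.ofReal_mul hinv] at key2
  refine key2.trans (add_le_add ?_ ?_)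
  · rw [← ENNReal.ofReal_toReal hC, ← ENNReal.ofReal_mul hinv]
    refine ENNReal.ofReal_le_ofReal ?_
    rw [ht, inv_div, div_mul_eq_mul_div, div_le_iff₀ (by positivity)]
    nlinarith
  · rw [inv_mul_eq_div]; rfl

/-- The bound is applied in one variable at a time; the second error gets multiplied by the first
constant $R$, hence the tolerance $\varepsilon/2/(R+1)$. -/
theorem UnifAC.lintegral_prod_le {S : Set (Measure I)} (hS : UnifAC S)
    (hprob : ∀ μ ∈ S, IsProbabilityMeasure μ) {ε : ℝ} (hε : 0 < ε) :
    ∃ R : ℝ≥0, ∀ μ ∈ S, ∀ H : I × I → ℝ≥0∞, Measurable H → (∀ p, H p ≤ 1) →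
      ∫⁻ p, H p ∂(μ.prod μ) ≤ ENNReal.ofReal ε + R * ∫⁻ p, H p := by
  obtain ⟨R, hR⟩ := hS (ε / 2) (half_pos hε)
  obtain ⟨R', hR'⟩ := hS (ε / 2 / (R + 1)) (by positivity)
  refine ⟨R * R', fun μ hμ H hH h1 => ?_⟩
  have := hprob μ hμ
  have hG : Measurable fun x => ∫⁻ y, H (x, y) := hH.lintegral_prod_right'
  calc ∫⁻ p, H p ∂(μ.prod μ) = ∫⁻ x, ∫⁻ y, H (x, y) ∂μ ∂μ := lintegral_prod _ hH.aemeasurable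
    _ ≤ ∫⁻ x, (ENNReal.ofReal (ε / 2) + R * ∫⁻ y, H (x, y)) ∂μ :=
        lintegral_mono fun x => hR μ hμ _ (hH.comp measurable_prodMk_left) fun y => h1 _
    _ = ENNReal.ofReal (ε / 2) + R * ∫⁻ x, (∫⁻ y, H (x, y)) ∂μ := by
        rw [lintegral_add_left measurable_const, lintegral_const_mul _ hG]; simp
    _ ≤ ENNReal.ofReal (ε / 2) + R * (ENNReal.ofReal (ε / 2 / (R + 1))
          + R' * ∫⁻ x, ∫⁻ y, H (x, y)) := by
        gcongr
        refine hR' μ hμ _ hG fun x => ?_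
        calc ∫⁻ y, H (x, y) ≤ ∫⁻ _ : I, 1 := lintegral_mono fun y => h1 _
          _ = 1 := by simp
    _ = (ENNReal.ofReal (ε / 2) + R * ENNReal.ofReal (ε / 2 / (R + 1)))
          + (R * R' : ℝ≥0) * ∫⁻ p, H p := by
        rw [Measure.volume_eq_prod, lintegral_prod _ hH.aemeasurable]
        push_cast
        ring
    _ ≤ _ := by
        gcongr
        rw [← ENNReal.ofReal_coe_nnreal, ← ENNReal.ofReal_mul R.coe_nonneg,
          ← ENNReal.ofReal_add (by positivity) (by positivity)]
        refine ENNReal.ofReal_le_ofReal ?_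
        have : (R : ℝ) * (ε / 2 / (R + 1)) ≤ ε / 2 := by
          rw [mul_div_assoc', div_le_iff₀ (by positivity)]
          nlinarith
        linarith

/-- The part $(f-n)^+$ of the density above level $n$ has small integral for large $n$, and the rest
is bounded by $n$. -/
theorem unifAC_singleton {μ : Measure I} [IsFiniteMeasure μ] (hμ : μ ≪ volume) :
    UnifAC {μ} := by
  intro ε hε
  set f : I → ℝ≥0∞ := μ.rnDeriv volume with hf
  have hfm : Measurable f := Measure.measurable_rnDeriv _ _
  have hlim : Tendsto (fun n : ℕ => ∫⁻ x, (f x - n)) atTop (𝓝 (∫⁻ _ : I, 0)) := by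
    refine tendsto_lintegral_of_dominated_convergence f (fun n => hfm.sub_const _)
      (fun n => Eventually.of_forall fun x => tsub_le_self) ?_ ?_
    · rw [hf, Measure.lintegral_rnDeriv hμ]
      exact measure_ne_top _ _
    · filter_upwards [Measure.rnDeriv_lt_top μ volume] with x hx
      obtain ⟨N, hN⟩ := ENNReal.exists_nat_gt hx.ne
      refine tendsto_const_nhds.congr' ?_
      filter_upwards [eventually_ge_atTop N] with n hn
      exact (tsub_eq_zero_of_le (hN.le.trans (by exact_mod_cast hn))).symm
  rw [lintegral_zero] at hlim
  obtain ⟨n, hn⟩ := (hlim.eventually_le_const (ENNReal.ofReal_pos.2 hε)).exists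
  refine ⟨n, ?_⟩
  rintro _ rfl h hm h1
  rw [← lintegral_rnDeriv_mul hμ hm.aemeasurable, ← lintegral_const_mul _ hm]
  calc ∫⁻ x, f x * h x ≤ ∫⁻ x, ((f x - n) + n * h x) := lintegral_mono fun x => by
        calc f x * h x ≤ ((f x - n) + n) * h x := by gcongr; exact le_tsub_add
          _ = (f x - n) * h x + n * h x := add_mul _ _ _
          _ ≤ _ := by gcongr; exact mul_le_of_le_one_right' (h1 x)
    _ = (∫⁻ x, (f x - n)) + ∫⁻ x, n * h x := lintegral_add_left (hfm.sub_const _) _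
    _ ≤ _ := by gcongr; simp

theorem UnifAC.union {S T : Set (Measure I)} (hS : UnifAC S) (hT : UnifAC T) :
    UnifAC (S ∪ T) := by
  intro ε hε
  obtain ⟨R, hR⟩ := hS ε hε
  obtain ⟨R', hR'⟩ := hT ε hε
  refine ⟨max R R', fun μ hμ h hm h1 => ?_⟩
  rcases hμ with hμ | hμ
  · refine (hR μ hμ h hm h1).trans ?_
    gcongr
    exact le_max_left _ _
  · refine (hR' μ hμ h hm h1).trans ?_
    gcongr
    exact le_max_right _ _

theorem UnifAC.of_le_smul {S T : Set (Measure I)} (hS : UnifAC S) {c : ℝ≥0}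
    (h : ∀ ν ∈ T, ∃ μ ∈ S, ν ≤ c • μ) : UnifAC T := by
  intro ε hε
  obtain ⟨R, hR⟩ := hS (ε / (c + 1)) (by positivity)
  refine ⟨c * R, fun ν hν g hm h1 => ?_⟩
  obtain ⟨μ, hμ, hle⟩ := h ν hν
  calc ∫⁻ x, g x ∂ν ≤ ∫⁻ x, g x ∂(c • μ) := lintegral_mono' hle le_rfl
    _ = c * ∫⁻ x, g x ∂μ := by rw [lintegral_smul_measure]; rfl
    _ ≤ c * (ENNReal.ofReal (ε / (c + 1)) + R * ∫⁻ x, g x) := by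
        gcongr
        exact hR μ hμ g hm h1
    _ = c * ENNReal.ofReal (ε / (c + 1)) + (c * R : ℝ≥0) * ∫⁻ x, g x := by push_cast; ring
    _ ≤ _ := by
        gcongr
        rw [← ENNReal.ofReal_coe_nnreal, ← ENNReal.ofReal_mul c.coe_nonneg]
        refine ENNReal.ofReal_le_ofReal ?_
        rw [mul_div_assoc', div_le_iff₀ (by positivity)]
        nlinarith

/-! ### Quantile functions and almost sure representation -/

/-- The quantile function of a measure on `[0,1]`. -/
def quantile (μ : Measure I) (t : I) : I := sSup {x | μ.real (Iic x) < t}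

theorem monotone_quantile (μ : Measure I) : Monotone (quantile μ) := fun _ _ h =>
  sSup_le_sSup fun x (hx : μ.real (Iic x) < _) => show μ.real (Iic x) < _ from hx.trans_le h

theorem measurable_quantile (μ : Measure I) : Measurable (quantile μ) :=
  (monotone_quantile μ).measurable

/-- The quantile is adjoint to the distribution function; the forward direction rests on
right-continuity of the latter. The point $x=1$ is treated apart because nothing in the interval
lies to its right. -/
theorem quantile_le_iff (μ : Measure I) [IsProbabilityMeasure μ] (t x : I) :
    quantile μ t ≤ x ↔ (t : ℝ) ≤ μ.real (Iic x) := by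
  have Iic_eq : ∀ y : I, Iic y = Icc 0 y := fun y => by ext; simp
  constructor
  · intro h
    by_cases hx : x = 1
    · have : Iic (1 : I) = univ := by ext y; simpa using (show y ≤ 1 from y.2.2)
      simpa [hx, this] using t.2.2
    have : NeBot (𝓝[>] x) := nhdsGT_neBot_of_exists_gt ⟨1, lt_of_le_of_ne x.2.2 hx⟩
    have hcont : ContinuousWithinAt (fun y : I => μ.real (Iic y)) (Ioi x) x := by
      have h1 := continuousWithinAt_Ioi_iff_Ici.2
        ((cdf (μ.map Subtype.val)).right_continuous (x : ℝ))
      simp_rw [Iic_eq, ← unitInterval.cdf_eq_real μ]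
      exact h1.comp (Continuous.continuousWithinAt (by fun_prop)) fun y hy => hy
    refine ge_of_tendsto hcont (eventually_nhdsWithin_of_forall fun y hy => ?_)
    by_contra! hlt
    have hle : y ≤ quantile μ t := le_sSup (show y ∈ {x | μ.real (Iic x) < t} from hlt)
    exact absurd (hle.trans h) (not_le.2 (mem_Ioi.1 hy))
  · intro h
    refine sSup_le fun y hy => ?_
    by_contra! hlt
    exact absurd (h.trans (measureReal_mono (Iic_subset_Iic.2 hlt.le))) (not_le.2 hy)

theorem measPres_quantile (μ : Measure I) [IsProbabilityMeasure μ] :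
    MeasPres (quantile μ) μ := by
  refine measPres_of_measurable (measurable_quantile μ) ?_
  refine Measure.ext_of_Iic _ _ fun x => ?_
  rw [Measure.map_apply (measurable_quantile μ) measurableSet_Iic]
  have h : μ.real (Iic x) ∈ I := ⟨measureReal_nonneg, measureReal_le_one⟩
  have : quantile μ ⁻¹' Iic x = Iic ⟨μ.real (Iic x), h⟩ := by
    ext t
    exact quantile_le_iff μ t x
  rw [this, unitInterval.volume_Iic, ofReal_measureReal]

theorem lt_quantile_imp {μ : Measure I} [IsProbabilityMeasure μ] {t x : I}
    (h : x < quantile μ t) : μ.real (Iic x) < t := by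
  by_contra! h'
  exact absurd ((quantile_le_iff μ t x).2 h') (not_le.2 h)

/-- The portmanteau inequality for the closed set `Iic x` gives this one-sided statement at every
$t$, with no exception at jumps of the quantile. -/
theorem eventually_lt_quantile {μs : ℕ → ProbabilityMeasure I} {μ : ProbabilityMeasure I}
    (h : Tendsto μs atTop (𝓝 μ)) {t x : I} (hx : x < quantile μ t) :
    ∀ᶠ n in atTop, x < quantile (μs n) t := by
  have h1 := lt_quantile_imp hx
  have h2 : limsup (fun n => (μs n : Measure I) (Iic x)) atTop ≤ (μ : Measure I) (Iic x) :=
    ProbabilityMeasure.limsup_measure_closed_le_of_tendsto h isClosed_Iic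
  have h3 : (μ : Measure I) (Iic x) < ENNReal.ofReal t := by
    rw [← ofReal_measureReal (measure_ne_top _ _)]
    exact (ENNReal.ofReal_lt_ofReal_iff_of_nonneg measureReal_nonneg).2 h1
  filter_upwards [eventually_lt_of_limsup_lt (h2.trans_lt h3)] with n hn
  by_contra! hle
  rw [quantile_le_iff] at hle
  rw [← ofReal_measureReal (measure_ne_top _ _)] at hn
  exact absurd (ENNReal.ofReal_le_ofReal hle) (not_le.2 hn)

theorem tendsto_max_quantile_sub {μs : ℕ → ProbabilityMeasure I} {μ : ProbabilityMeasure I}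
    (h : Tendsto μs atTop (𝓝 μ)) (t : I) :
    Tendsto (fun n => max ((quantile μ t : ℝ) - quantile (μs n) t) 0) atTop (𝓝 0) := by
  refine tendsto_order.2 ⟨fun a ha => Eventually.of_forall fun n => ha.trans_le
    (le_max_right _ _), fun a ha => ?_⟩
  by_cases h0 : (quantile μ t : ℝ) < a
  · refine Eventually.of_forall fun n => max_lt ?_ ha
    have := (quantile (μs n) t).2.1
    linarith
  · have hq := (quantile μ t).2
    have hx : (quantile μ t : ℝ) - a ∈ I := ⟨by linarith, by linarith [hq.2]⟩
    have hlt : (⟨(quantile μ t : ℝ) - a, hx⟩ : I) < quantile μ t :=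
      Subtype.coe_lt_coe.1 (by simpa using ha)
    filter_upwards [eventually_lt_quantile h hlt] with n hn
    have hn' : (quantile μ t : ℝ) - a < quantile (μs n) t := hn
    exact max_lt (by linarith) ha

theorem tendsto_integral_quantile {μs : ℕ → ProbabilityMeasure I} {μ : ProbabilityMeasure I}
    (h : Tendsto μs atTop (𝓝 μ)) :
    Tendsto (fun n => ∫ t, (quantile (μs n) t : ℝ)) atTop (𝓝 (∫ t, (quantile μ t : ℝ))) := by
  have key : ∀ ν : ProbabilityMeasure I,
      ∫ t, (quantile ν t : ℝ) = ∫ x : I, (x : ℝ) ∂(ν : Measure I) := fun ν => by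
    conv_rhs => rw [← (measPres_quantile (ν : Measure I)).map_eq]
    rw [integral_map (measurable_quantile _).aemeasurable
      measurable_subtype_coe.aestronglyMeasurable]
  simp_rw [key]
  exact ProbabilityMeasure.tendsto_iff_forall_integral_tendsto.1 h
    (BoundedContinuousFunction.mkOfCompact ⟨fun x : I => (x : ℝ), continuous_subtype_val⟩)

theorem integrable_quantile (μ : Measure I) :
    Integrable (fun t => (quantile μ t : ℝ)) volume :=
  Integrable.of_bound (measurable_subtype_coe.comp (measurable_quantile μ)).aestronglyMeasurable
    1 (Eventually.of_forall fun t => by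
      rw [Real.norm_eq_abs, abs_of_nonneg (quantile μ t).2.1]; exact (quantile μ t).2.2)

/-- Scheffé's argument: one-sided convergence of the quantiles together with convergence of their
means yields $L^1$ convergence. -/
theorem tendsto_integral_abs_quantile_sub {μs : ℕ → ProbabilityMeasure I}
    {μ : ProbabilityMeasure I} (h : Tendsto μs atTop (𝓝 μ)) :
    Tendsto (fun n => ∫ t, |(quantile (μs n) t : ℝ) - quantile μ t|) atTop (𝓝 0) := by
  have hint : ∀ n, Integrable
      (fun t => max ((quantile μ t : ℝ) - quantile (μs n) t) 0) volume := fun n =>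
    ((integrable_quantile μ).sub (integrable_quantile (μs n))).pos_part
  have h1 : Tendsto (fun n => ∫ t, max ((quantile μ t : ℝ) - quantile (μs n) t) 0) atTop
      (𝓝 (∫ _ : I, (0 : ℝ))) := by
    refine tendsto_integral_of_dominated_convergence (fun _ => 1)
      (fun n => (hint n).aestronglyMeasurable) (integrable_const 1) (fun n => ?_)
      (Eventually.of_forall (tendsto_max_quantile_sub h))
    refine Eventually.of_forall fun t => ?_
    rw [Real.norm_eq_abs, abs_of_nonneg (le_max_right _ _)]
    exact max_le (by linarith [(quantile μ t).2.2, (quantile (μs n) t).2.1]) zero_le_one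
  have h2 := tendsto_integral_quantile h
  -- Integrates $|a-b|=2\max(b-a,0)+(a-b)$.
  have h3 : ∀ n, ∫ t, |(quantile (μs n) t : ℝ) - quantile μ t|
      = 2 * (∫ t, max ((quantile μ t : ℝ) - quantile (μs n) t) 0)
        + ((∫ t, (quantile (μs n) t : ℝ)) - ∫ t, (quantile μ t : ℝ)) := fun n => by
    have hsub : Integrable
        (fun t => (quantile (μs n) t : ℝ) - (quantile μ t : ℝ)) volume :=
      (integrable_quantile _).sub (integrable_quantile _)
    rw [← integral_sub (integrable_quantile _) (integrable_quantile _), ← integral_const_mul,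
      ← integral_add ((hint n).const_mul 2) hsub]
    refine integral_congr_ae (Eventually.of_forall fun t => ?_)
    dsimp only
    rcases le_total (quantile μ t : ℝ) (quantile (μs n) t) with hle | hle
    · rw [max_eq_right (by linarith), abs_of_nonneg (by linarith)]; ring
    · rw [max_eq_left (by linarith), abs_of_nonpos (by linarith)]; ring
  simp_rw [h3]
  have h4 := (h1.const_mul 2).add (h2.sub_const (∫ t, (quantile μ t : ℝ)))
  simpa using h4

theorem exists_subseq_tendsto_of_integral_abs {α : Type*} [MeasurableSpace α] {ν : Measure α}
    {f : ℕ → α → ℝ} {g : α → ℝ} (hf : ∀ n, Integrable (f n) ν) (hg : Integrable g ν)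
    (h : Tendsto (fun n => ∫ x, |f n x - g x| ∂ν) atTop (𝓝 0)) :
    ∃ ns : ℕ → ℕ, StrictMono ns ∧ ∀ᵐ x ∂ν, Tendsto (fun k => f (ns k) x) atTop (𝓝 (g x)) := by
  refine TendstoInMeasure.exists_seq_tendsto_ae ?_
  refine tendstoInMeasure_of_tendsto_eLpNorm one_ne_zero (fun n => (hf n).aestronglyMeasurable)
    hg.aestronglyMeasurable ?_
  have h1 : ∀ n, eLpNorm (f n - g) 1 ν = ENNReal.ofReal (∫ x, |f n x - g x| ∂ν) := fun n => by
    rw [eLpNorm_one_eq_lintegral_enorm, ← ofReal_integral_norm_eq_lintegral_enorm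
      ((hf n).sub hg)]
    rfl
  simp_rw [h1]
  simpa using ENNReal.tendsto_ofReal h

theorem exists_subseq_tendsto_quantile {μs : ℕ → ProbabilityMeasure I}
    {μ : ProbabilityMeasure I} (h : Tendsto μs atTop (𝓝 μ)) :
    ∃ ns : ℕ → ℕ, StrictMono ns ∧
      ∀ᵐ t : I, Tendsto (fun k => quantile (μs (ns k)) t) atTop (𝓝 (quantile μ t)) := by
  obtain ⟨ns, hns, h1⟩ := exists_subseq_tendsto_of_integral_abs
    (fun n => integrable_quantile (μs n)) (integrable_quantile μ)
    (tendsto_integral_abs_quantile_sub h)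
  exact ⟨ns, hns, h1.mono fun t ht => tendsto_subtype_rng.2 ht⟩

/-! ### From weak convergence to cut distance -/

/-- Retraction of the real line onto `[a, b]`. -/
def clamp (a b y : ℝ) : ℝ := max a (min y b)

theorem continuous_clamp (a b : ℝ) : Continuous (clamp a b) := by unfold clamp; fun_prop

theorem le_clamp (a b y : ℝ) : a ≤ clamp a b y := le_max_left _ _

theorem clamp_le {a b : ℝ} (h : a ≤ b) (y : ℝ) : clamp a b y ≤ b := max_le h (min_le_right _ _)

theorem abs_sub_clamp_le {a b x : ℝ} (h1 : a ≤ x) (h2 : x ≤ b) (y : ℝ) :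
    |x - clamp a b y| ≤ |x - y| := by
  unfold clamp
  rcases le_total y b with hb | hb
  · rw [min_eq_left hb]
    rcases le_total y a with ha | ha
    · rw [max_eq_left ha, abs_of_nonneg (by linarith), abs_of_nonneg (by linarith)]
      linarith
    · rw [max_eq_right ha]
  · rw [min_eq_right hb, max_eq_right (h1.trans h2), abs_of_nonpos (by linarith),
      abs_of_nonpos (by linarith)]
    linarith

/-- Approximation in `L¹` by continuous functions with the same bounds. -/
theorem exists_continuous_integral_sub_le {α : Type*} [TopologicalSpace α] [NormalSpace α]
    [MeasurableSpace α] [BorelSpace α] {ν : Measure α} [ν.WeaklyRegular] [IsFiniteMeasure ν]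
    {f : α → ℝ} (hf : AEStronglyMeasurable f ν) {a b : ℝ} (h1 : ∀ x, a ≤ f x)
    (h2 : ∀ x, f x ≤ b) {ε : ℝ} (hε : 0 < ε) :
    ∃ g : α → ℝ, Continuous g ∧ (∀ x, a ≤ g x) ∧ (∀ x, a ≤ b → g x ≤ b) ∧
      ∫ x, |f x - g x| ∂ν ≤ ε := by
  have hint : Integrable f ν := Integrable.of_bound hf (max |a| |b|)
    (Eventually.of_forall fun x => abs_le_max_abs_abs (h1 x) (h2 x))
  obtain ⟨g, hg, hgi⟩ := hint.exists_boundedContinuous_integral_sub_le hε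
  refine ⟨fun x => clamp a b (g x), (continuous_clamp a b).comp g.continuous,
    fun x => le_clamp _ _ _, fun x hab => clamp_le hab _, le_trans ?_ hg⟩
  refine integral_mono_of_nonneg (Eventually.of_forall fun x => abs_nonneg _)
    (hint.sub hgi).norm (Eventually.of_forall fun x => ?_)
  exact abs_sub_clamp_le (h1 x) (h2 x) _

theorem absolutelyContinuous_prod {μ : Measure I} [SFinite μ] (hμ : μ ≪ volume) :
    μ.prod μ ≪ (volume : Measure (I × I)) := by
  rw [Measure.volume_eq_prod]
  exact hμ.prod hμ

/-- A graphon has continuous `L¹`-approximations which are good simultaneously for all pull-backs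
along maps whose laws are uniformly absolutely continuous. -/
theorem exists_continuous_approx (W : Graphon) {S : Set (Measure I)} (hS : UnifAC S)
    (hprob : ∀ μ ∈ S, IsProbabilityMeasure μ) (hac : ∀ μ ∈ S, μ ≪ volume) {ε : ℝ}
    (hε : 0 < ε) :
    ∃ g : I × I → ℝ, Continuous g ∧ (∀ p, 0 ≤ g p) ∧ (∀ p, g p ≤ 1) ∧
      ∀ μ ∈ S, ∀ φ : I → I, Measurable φ → (volume : Measure I).map φ = μ →
        ∫ p : I × I, |W.toFun (φ p.1) (φ p.2) - g (φ p.1, φ p.2)| ≤ ε := by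
  obtain ⟨R, hR⟩ := hS.lintegral_prod_le hprob (half_pos hε)
  -- The error under $\lambda^{\otimes2}$ is later multiplied by $R$, and must then stay below
  -- $\varepsilon/2$.
  obtain ⟨g, hg, hg0, hg1, hgε⟩ := exists_continuous_integral_sub_le W.aestronglyMeasurable
    (fun p => W.nonneg p.1 p.2) (fun p => W.le_one p.1 p.2)
    (show 0 < ε / 2 / (R + 1) by positivity)
  have hg1' : ∀ p, g p ≤ 1 := fun p => hg1 p zero_le_one
  refine ⟨g, hg, hg0, hg1', fun μ hμ φ hφ hφμ => ?_⟩
  have := hprob μ hμ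
  have hμac : μ.prod μ ≪ (volume : Measure (I × I)) := absolutelyContinuous_prod (hac μ hμ)
  let F : I × I → ℝ := fun p => |W.toFun p.1 p.2 - g p|
  have hF : AEStronglyMeasurable F volume :=
    (W.aestronglyMeasurable.sub hg.aestronglyMeasurable).norm
  have hF0 : ∀ p, 0 ≤ F p := fun p => abs_nonneg _
  have hF1 : ∀ p, F p ≤ 1 := fun p =>
    abs_sub_le_one (W.nonneg p.1 p.2) (W.le_one p.1 p.2)
      (hg0 p) (hg1' p)
  have hFi : Integrable F volume := Integrable.of_bound hF 1
    (Eventually.of_forall fun p => by rw [Real.norm_eq_abs, abs_of_nonneg (hF0 p)]; exact hF1 p)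
  -- Uniform absolute continuity asks for a measurable integrand bounded by $1$ everywhere, so a
  -- measurable version is capped.
  let H : I × I → ℝ≥0∞ := fun p => min (ENNReal.ofReal (hF.mk F p)) 1
  have hHm : Measurable H :=
    (hF.stronglyMeasurable_mk.measurable.ennreal_ofReal).min measurable_const
  have hHF : ∀ᵐ p, H p = ENNReal.ofReal (F p) := by
    filter_upwards [hF.ae_eq_mk] with p hp
    simp only [H, ← hp]
    exact min_eq_left (by rw [← ENNReal.ofReal_one]; exact ENNReal.ofReal_le_ofReal (hF1 p))
  have hlin : ∫⁻ p, ENNReal.ofReal (F p) ∂(μ.prod μ) ≤ ENNReal.ofReal ε := by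
    rw [← lintegral_congr_ae (hμac.ae_le hHF)]
    refine (hR μ hμ H hHm fun p => min_le_right _ _).trans ?_
    rw [lintegral_congr_ae hHF, ← ofReal_integral_eq_lintegral_ofReal hFi
      (Eventually.of_forall hF0), ← ENNReal.ofReal_coe_nnreal,
      ← ENNReal.ofReal_mul R.coe_nonneg,
      ← ENNReal.ofReal_add (by positivity)
        (mul_nonneg R.coe_nonneg (integral_nonneg hF0))]
    refine ENNReal.ofReal_le_ofReal ?_
    have h1 : (R : ℝ) * ∫ p, F p ≤ R * (ε / 2 / (R + 1)) :=
      mul_le_mul_of_nonneg_left hgε R.coe_nonneg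
    have h2 : (R : ℝ) * (ε / 2 / (R + 1)) ≤ ε / 2 := by
      rw [mul_div_assoc', div_le_iff₀ (by positivity)]
      nlinarith [R.coe_nonneg]
    linarith
  have hmap : (volume : Measure (I × I)).map (Prod.map φ φ) = μ.prod μ := by
    rw [Measure.volume_eq_prod, ← Measure.map_prod_map _ _ hφ hφ, hφμ]
  have hFμ : AEStronglyMeasurable F (volume.map (Prod.map φ φ)) := by
    rw [hmap]
    exact hF.mono_ac hμac
  calc ∫ p : I × I, |W.toFun (φ p.1) (φ p.2) - g (φ p.1, φ p.2)|
      = ∫ p, F p ∂(μ.prod μ) := by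
        rw [← hmap, integral_map (hφ.prodMap hφ).aemeasurable hFμ]
        rfl
    _ = (∫⁻ p, ENNReal.ofReal (F p) ∂(μ.prod μ)).toReal :=
        integral_eq_lintegral_of_nonneg_ae (Eventually.of_forall hF0) (hF.mono_ac hμac)
    _ ≤ ε := ENNReal.toReal_le_of_le_ofReal hε.le hlin

/-- An element of `ACProb` as a probability measure. -/
def ACProb.toProb (μ : ACProb) : ProbabilityMeasure I := ⟨μ.1, μ.2.1⟩

/-- Quantile maps represent the $W_{\mu_n}$ and $W_\mu$ on one space. With $g$ continuous and close
to $W$ under all these laws, three errors of $\varepsilon/3$ suffice; the middle one tends to $0$ by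
dominated convergence. -/
theorem exists_subseq_tendsto_cutDist (W : Graphon) {μs : ℕ → ACProb} {μ : ACProb}
    (h : Tendsto (fun n => (μs n).toProb) atTop (𝓝 μ.toProb))
    (hS : UnifAC (range fun n => (μs n).1)) :
    ∃ ns : ℕ → ℕ, StrictMono ns ∧
      Tendsto (fun k => cutDist (W.reweight (μs (ns k))) (W.reweight μ)) atTop (𝓝 0) := by
  obtain ⟨ns, hns, hlim⟩ := exists_subseq_tendsto_quantile h
  refine ⟨ns, hns, ?_⟩
  have := μ.2.1
  set S : Set (Measure I) := range (fun n => (μs n).1) ∪ {μ.1} with hSdef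
  have hS' : UnifAC S := hS.union (unifAC_singleton μ.2.2)
  have hmem : ∀ ν ∈ S, ∃ ν' : ACProb, ν'.1 = ν := by
    rintro ν (⟨n, rfl⟩ | rfl)
    · exact ⟨μs n, rfl⟩
    · exact ⟨μ, rfl⟩
  refine tendsto_order.2 ⟨fun a ha => Eventually.of_forall fun k => ha.trans_le
    (cutDist_nonneg _ _), fun ε hε => ?_⟩
  obtain ⟨g, hg, hg0, hg1, happ⟩ := W.exists_continuous_approx hS'
    (fun ν hν => by obtain ⟨ν', rfl⟩ := hmem ν hν; exact ν'.2.1)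
    (fun ν hν => by obtain ⟨ν', rfl⟩ := hmem ν hν; exact ν'.2.2) (show 0 < ε / 3 by positivity)
  let q : ℕ → I → I := fun k => quantile (μs (ns k)).1
  let r : I → I := quantile μ.1
  have hgq : ∀ s : I → I, Measurable s → ∀ s' : I → I, Measurable s' →
      Integrable (fun p : I × I => |g (s p.1, s p.2) - g (s' p.1, s' p.2)|) volume :=
    fun s hs s' hs' => by
      refine Integrable.of_bound (C := 1) ?_ (Eventually.of_forall fun p => ?_)
      · exact (((hg.measurable.comp (hs.prodMap hs)).sub
          (hg.measurable.comp (hs'.prodMap hs'))).aestronglyMeasurable).norm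
      · rw [Real.norm_eq_abs, abs_abs]
        exact abs_sub_le_one (hg0 (s p.1, s p.2)) (hg1 (s p.1, s p.2))
          (hg0 (s' p.1, s' p.2)) (hg1 (s' p.1, s' p.2))
  have hmid : Tendsto
      (fun k => ∫ p : I × I, |g (q k p.1, q k p.2) - g (r p.1, r p.2)|) atTop
      (𝓝 (∫ _ : I × I, (0 : ℝ))) := by
    refine tendsto_integral_of_dominated_convergence (fun _ => 1)
      (fun k => (hgq _ (measurable_quantile _) _ (measurable_quantile _)).aestronglyMeasurable)
      (integrable_const 1) (fun k => Eventually.of_forall fun p => ?_) ?_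
    · rw [Real.norm_eq_abs, abs_abs]
      exact abs_sub_le_one (hg0 (q k p.1, q k p.2)) (hg1 (q k p.1, q k p.2))
        (hg0 (r p.1, r p.2)) (hg1 (r p.1, r p.2))
    · have hfst : ∀ᵐ p : I × I, Tendsto (fun k => q k p.1) atTop (𝓝 (r p.1)) :=
        Measure.quasiMeasurePreserving_fst.ae hlim
      have hsnd : ∀ᵐ p : I × I, Tendsto (fun k => q k p.2) atTop (𝓝 (r p.2)) :=
        Measure.quasiMeasurePreserving_snd.ae hlim
      filter_upwards [hfst, hsnd] with p h1 h2
      have h3 : Tendsto (fun k => g (q k p.1, q k p.2)) atTop (𝓝 (g (r p.1, r p.2))) :=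
        (hg.tendsto _).comp (h1.prodMk_nhds h2)
      have h4 := (h3.sub_const (g (r p.1, r p.2))).abs
      simpa using h4
  rw [integral_zero] at hmid
  filter_upwards [hmid.eventually_lt_const (show 0 < ε / 3 by positivity)] with k hk
  have := (μs (ns k)).2.1
  have hq := measPres_quantile (μs (ns k)).1
  have hr := measPres_quantile μ.1
  have e1 := happ _ (Or.inl ⟨ns k, rfl⟩) (q k) (measurable_quantile _) hq.map_eq
  have e2 := happ μ.1 (Or.inr rfl) r (measurable_quantile _) hr.map_eq
  have hi : ∀ (ν : ACProb) (s : I → I) (hs : Measurable s), (volume : Measure I).map s = ν.1 →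
      Integrable (fun p : I × I => |W.toFun (s p.1) (s p.2) - g (s p.1, s p.2)|) volume :=
    fun ν s hs hsν => by
      have hA := (W.pullback s (measPres_of_measurable hs hsν) ν.2.2).aestronglyMeasurable
      refine Integrable.of_bound (C := 1) (hA.sub
        (hg.measurable.comp (hs.prodMap hs)).aestronglyMeasurable).norm
        (Eventually.of_forall fun p => ?_)
      rw [Real.norm_eq_abs, abs_abs]
      exact abs_sub_le_one (W.nonneg (s p.1) (s p.2)) (W.le_one (s p.1) (s p.2))
        (hg0 (s p.1, s p.2)) (hg1 (s p.1, s p.2))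
  have i1 := hi (μs (ns k)) (q k) (measurable_quantile _) hq.map_eq
  have i2 := hi μ r (measurable_quantile _) hr.map_eq
  have i3 := hgq (q k) (measurable_quantile _) r (measurable_quantile _)
  have i13 : Integrable (fun p : I × I => |W.toFun (q k p.1) (q k p.2) - g (q k p.1, q k p.2)|
      + |g (q k p.1, q k p.2) - g (r p.1, r p.2)|) volume := i1.add i3
  calc cutDist (W.reweight (μs (ns k))) (W.reweight μ)
      ≤ ∫ p : I × I, |W.toFun (q k p.1) (q k p.2) - W.toFun (r p.1) (r p.2)| :=
        (W.cutDist_reweight_le _ _ hq hr).trans (cutNormDist_le_integral _ _)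
    _ ≤ ∫ p : I × I, (|W.toFun (q k p.1) (q k p.2) - g (q k p.1, q k p.2)|
          + |g (q k p.1, q k p.2) - g (r p.1, r p.2)|
          + |W.toFun (r p.1) (r p.2) - g (r p.1, r p.2)|) := by
        refine integral_mono_of_nonneg (Eventually.of_forall fun p => abs_nonneg _)
          (i13.add i2) (Eventually.of_forall fun p => ?_)
        dsimp only
        rw [abs_sub_comm (W.toFun (r p.1) (r p.2)) (g (r p.1, r p.2))]
        exact (abs_sub_le _ (g (r p.1, r p.2)) _).trans
          (add_le_add_left (abs_sub_le _ (g (q k p.1, q k p.2)) _) _)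
    _ = (∫ p : I × I, |W.toFun (q k p.1) (q k p.2) - g (q k p.1, q k p.2)|)
          + (∫ p : I × I, |g (q k p.1, q k p.2) - g (r p.1, r p.2)|)
          + ∫ p : I × I, |W.toFun (r p.1) (r p.2) - g (r p.1, r p.2)| := by
        rw [integral_add i13 i2, integral_add i1 i3]
    _ < ε := by linarith

/-! ### Lower semicontinuity of the divergence -/

theorem integral_le_klDiv_add {μ : Measure I} [IsFiniteMeasure μ] (hμ : μ ≪ volume) {C : ℝ≥0}
    (hC : klDiv μ volume ≤ C) {g : I → ℝ} (hg : Measurable g) {M : ℝ} (hM : ∀ x, |g x| ≤ M) :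
    ∫ x, g x ∂μ ≤ C + ∫ x, (Real.exp (g x) - 1) := by
  have hne : klDiv μ volume ≠ ∞ := ne_top_of_le_ne_top ENNReal.coe_ne_top hC
  have hk : Integrable (fun x => klFun (μ.rnDeriv volume x).toReal) volume :=
    (integrable_klFun_rnDeriv_iff hμ).2 (klDiv_ne_top_iff.1 hne).2
  have hgi : Integrable g μ :=
    Integrable.of_bound hg.aestronglyMeasurable M (Eventually.of_forall hM)
  have hfg : Integrable (fun x => (μ.rnDeriv volume x).toReal * g x) volume :=
    (integrable_rnDeriv_smul_iff hμ).2 hgi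
  have he : Integrable (fun x => Real.exp (g x) - 1) (volume : Measure I) := by
    refine (Integrable.of_bound (C := Real.exp M)
      (Real.measurable_exp.comp hg).aestronglyMeasurable
      (Eventually.of_forall fun x => ?_)).sub (integrable_const 1)
    rw [Real.norm_eq_abs, Function.comp_apply, abs_of_pos (Real.exp_pos _)]
    exact Real.exp_le_exp.2 ((le_abs_self _).trans (hM x))
  calc ∫ x, g x ∂μ = ∫ x, (μ.rnDeriv volume x).toReal * g x := (integral_rnDeriv_smul hμ).symm
    _ ≤ ∫ x, (klFun (μ.rnDeriv volume x).toReal + (Real.exp (g x) - 1)) :=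
        integral_mono hfg (hk.add he) fun x => mul_le_klFun_add ENNReal.toReal_nonneg _
    _ = (klDiv μ volume).toReal + ∫ x, (Real.exp (g x) - 1) := by
        rw [integral_add hk he, toReal_klDiv_eq_integral_klFun hμ]
    _ ≤ _ := by
        gcongr
        exact ENNReal.toReal_mono ENNReal.coe_ne_top hC

/-- A null set has an open neighbourhood of small Lebesgue measure. All the $\mu_n$ are uniformly
small on it, and mass of open sets passes to weak limits by the portmanteau theorem. -/
theorem absolutelyContinuous_of_tendsto {μs : ℕ → ProbabilityMeasure I}
    {μ : ProbabilityMeasure I} (h : Tendsto μs atTop (𝓝 μ))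
    (hS : UnifAC (range fun n => (μs n : Measure I))) : (μ : Measure I) ≪ volume := by
  refine Measure.AbsolutelyContinuous.mk fun A _ hA0 => ?_
  refine le_antisymm (ENNReal.le_of_forall_pos_le_add fun ε hε _ => ?_) zero_le
  rw [zero_add]
  obtain ⟨R, hR⟩ := hS (ε / 2) (by positivity)
  obtain ⟨O, hAO, hO, hOlt⟩ := A.exists_isOpen_lt_of_lt
    (ENNReal.ofReal (ε / 2 / (R + 1))) (μ := volume)
    (by rw [hA0]; exact ENNReal.ofReal_pos.2 (by positivity))
  have hopen : ∀ n, (μs n : Measure I) O ≤ ε := fun n => by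
    have h1 := hR _ ⟨n, rfl⟩ (O.indicator 1) (measurable_one.indicator hO.measurableSet)
      (fun x => indicator_le_self' (fun _ _ => zero_le) x)
    simp only [lintegral_indicator_one hO.measurableSet] at h1
    refine h1.trans ?_
    calc ENNReal.ofReal (ε / 2) + R * volume O
        ≤ ENNReal.ofReal (ε / 2) + R * ENNReal.ofReal (ε / 2 / (R + 1)) := by gcongr
      _ ≤ ε := by
        rw [← ENNReal.ofReal_coe_nnreal, ← ENNReal.ofReal_mul R.coe_nonneg,
          ← ENNReal.ofReal_add (by positivity) (by positivity), ← ENNReal.ofReal_coe_nnreal]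
        refine ENNReal.ofReal_le_ofReal ?_
        have : (R : ℝ) * (ε / 2 / (R + 1)) ≤ ε / 2 := by
          rw [mul_div_assoc', div_le_iff₀ (by positivity)]
          nlinarith [R.coe_nonneg, ε.coe_nonneg]
        linarith
  calc (μ : Measure I) A ≤ (μ : Measure I) O := measure_mono hAO
    _ ≤ liminf (fun n => (μs n : Measure I) O) atTop :=
        ProbabilityMeasure.le_liminf_measure_open_of_tendsto h hO
    _ ≤ liminf (fun _ => (ε : ℝ≥0∞)) atTop := liminf_le_liminf (Eventually.of_forall hopen)
    _ = ε := liminf_const _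

/-- A Young-type inequality for bounded measurable functions follows from the one for continuous
functions. -/
theorem integral_le_of_forall_continuous {μ : Measure I} [IsFiniteMeasure μ] (hμ : μ ≪ volume)
    {C : ℝ} (h : ∀ g : I → ℝ, Continuous g → ∫ x, g x ∂μ ≤ C + ∫ x, (Real.exp (g x) - 1))
    {g : I → ℝ} (hg : Measurable g) {M : ℝ} (hM : ∀ x, |g x| ≤ M) :
    ∫ x, g x ∂μ ≤ C + ∫ x, (Real.exp (g x) - 1) := by
  have hM0 : -M ≤ M := by linarith [(abs_nonneg _).trans (hM 0)]
  have hex : ∀ n : ℕ, ∃ f : I → ℝ, Continuous f ∧ (∀ x, |f x| ≤ M) ∧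
      ∫ x, |g x - f x| ≤ 1 / ((n : ℝ) + 1) := fun n => by
    obtain ⟨f, hf, h1, h2, h3⟩ := exists_continuous_integral_sub_le (ν := volume)
      hg.aestronglyMeasurable (fun x => (abs_le.1 (hM x)).1) (fun x => (abs_le.1 (hM x)).2)
      (show 0 < 1 / ((n : ℝ) + 1) by positivity)
    exact ⟨f, hf, fun x => abs_le.2 ⟨h1 x, h2 x hM0⟩, h3⟩
  choose f hf hfM hfg using hex
  have hint : ∀ f : I → ℝ, Measurable f → (∀ x, |f x| ≤ M) → Integrable f volume :=
    fun f hf hfM => Integrable.of_bound hf.aestronglyMeasurable M (Eventually.of_forall hfM)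
  have hlim : Tendsto (fun n => ∫ x, |f n x - g x|) atTop (𝓝 0) := by
    refine squeeze_zero (fun n => integral_nonneg fun x => abs_nonneg _) (fun n => ?_)
      tendsto_one_div_add_atTop_nhds_zero_nat
    simp_rw [abs_sub_comm (f n _)]
    exact hfg n
  obtain ⟨ns, -, hns⟩ := exists_subseq_tendsto_of_integral_abs
    (fun n => hint _ (hf n).measurable (hfM n)) (hint g hg hM) hlim
  have l1 : Tendsto (fun k => ∫ x, f (ns k) x ∂μ) atTop (𝓝 (∫ x, g x ∂μ)) :=
    tendsto_integral_of_dominated_convergence (fun _ => M)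
      (fun k => (hf _).aestronglyMeasurable) (integrable_const M)
      (fun k => Eventually.of_forall (hfM _)) (hμ.ae_le hns)
  have l2 : Tendsto (fun k => ∫ x, (Real.exp (f (ns k) x) - 1)) atTop
      (𝓝 (∫ x, (Real.exp (g x) - 1))) := by
    refine tendsto_integral_of_dominated_convergence (fun _ => Real.exp M + 1)
      (fun k => ((Real.continuous_exp.comp (hf _)).sub continuous_const).aestronglyMeasurable)
      (integrable_const _) (fun k => Eventually.of_forall fun x => ?_) ?_
    · have h1 := Real.exp_pos (f (ns k) x)
      have h2 := Real.exp_le_exp.2 ((le_abs_self _).trans (hfM (ns k) x))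
      exact abs_le.2 ⟨by linarith [Real.exp_pos M], by linarith⟩
    · filter_upwards [hns] with x hx
      exact ((Real.continuous_exp.tendsto _).comp hx).sub_const 1
  exact le_of_tendsto_of_tendsto' l1 (l2.const_add C) fun k => h _ (hf _)

/-- Clamping to $[M^{-1},M]$ changes $y$ upwards only where the logarithm is nonpositive and
downwards only where it is nonnegative. The resulting nonnegativity of the right-hand side permits
Fatou's lemma below. -/
theorem klFun_clamp_le {y M : ℝ} (hM : 1 ≤ M) :
    klFun (clamp M⁻¹ M y)
      ≤ y * Real.log (clamp M⁻¹ M y) - (clamp M⁻¹ M y - 1) := by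
  have h0 : M⁻¹ ≤ 1 := inv_le_one_of_one_le₀ hM
  have hpos : 0 < M⁻¹ := inv_pos.2 (by linarith)
  suffices h : 0 ≤ (y - clamp M⁻¹ M y) * Real.log (clamp M⁻¹ M y) by
    rw [klFun_apply]; linarith
  unfold clamp
  rcases le_total y M with hb | hb
  · rw [min_eq_left hb]
    rcases le_total y M⁻¹ with ha | ha
    · rw [max_eq_left ha]
      exact mul_nonneg_of_nonpos_of_nonpos (by linarith) (Real.log_nonpos hpos.le h0)
    · rw [max_eq_right ha]; simp
  · rw [min_eq_right hb, max_eq_right (h0.trans hM)]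
    exact mul_nonneg (by linarith) (Real.log_nonneg hM)

theorem tendsto_mul_log_clamp {y : ℝ} (hy : 0 ≤ y) :
    Tendsto (fun n : ℕ => y * Real.log (clamp ((n : ℝ) + 1)⁻¹ (n + 1) y)
      - (clamp ((n : ℝ) + 1)⁻¹ (n + 1) y - 1)) atTop (𝓝 (klFun y)) := by
  have hinv : Tendsto (fun n : ℕ => ((n : ℝ) + 1)⁻¹) atTop (𝓝 0) := by
    simpa using tendsto_one_div_add_atTop_nhds_zero_nat (𝕜 := ℝ)
  rcases hy.eq_or_lt with rfl | hy
  · have h : ∀ n : ℕ, clamp ((n : ℝ) + 1)⁻¹ (n + 1) 0 = ((n : ℝ) + 1)⁻¹ := fun n => by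
      rw [clamp, min_eq_left (by positivity), max_eq_left (by positivity)]
    simp_rw [h]
    simpa [klFun_zero] using (hinv.sub_const 1).neg
  · refine tendsto_const_nhds.congr' ?_
    obtain ⟨N, hN⟩ := exists_nat_ge y
    filter_upwards [hinv.eventually_le_const hy, eventually_ge_atTop N] with n h1 h2
    have h3 : y ≤ (n : ℝ) + 1 := by
      have : (N : ℝ) ≤ n := by exact_mod_cast h2
      linarith
    rw [clamp, min_eq_left h3, max_eq_right h1, klFun_apply]
    ring

/-- The optimal test function is the logarithm of the density, which may be unbounded. Its
truncations are admissible, and Fatou's lemma removes the truncation. -/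
theorem klDiv_le_of_forall_integral_le {μ : Measure I} [IsFiniteMeasure μ] (hμ : μ ≪ volume)
    {C : ℝ} (h : ∀ (g : I → ℝ) (M : ℝ), Measurable g → (∀ x, |g x| ≤ M) →
      ∫ x, g x ∂μ ≤ C + ∫ x, (Real.exp (g x) - 1)) :
    klDiv μ volume ≤ ENNReal.ofReal C := by
  rw [klDiv_eq_lintegral_klFun_of_ac hμ]
  set y : I → ℝ := fun x => (μ.rnDeriv volume x).toReal with hy
  have hym : Measurable y := (Measure.measurable_rnDeriv _ _).ennreal_toReal
  have hy0 : ∀ x, 0 ≤ y x := fun x => ENNReal.toReal_nonneg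
  let z : ℕ → I → ℝ := fun n x => clamp ((n : ℝ) + 1)⁻¹ (n + 1) (y x)
  have hzm : ∀ n, Measurable (z n) := fun n => (continuous_clamp _ _).measurable.comp hym
  have hn1 : ∀ n : ℕ, (1 : ℝ) ≤ (n : ℝ) + 1 := fun n => by
    have : (0 : ℝ) ≤ n := n.cast_nonneg
    linarith
  have hz1 : ∀ (n : ℕ) x, ((n : ℝ) + 1)⁻¹ ≤ z n x := fun n x => le_clamp _ _ _
  have hz2 : ∀ (n : ℕ) x, z n x ≤ (n : ℝ) + 1 := fun n x =>
    clamp_le ((inv_le_one_of_one_le₀ (hn1 n)).trans (hn1 n)) _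
  have hz0 : ∀ (n : ℕ) x, 0 < z n x := fun n x =>
    lt_of_lt_of_le (inv_pos.2 (by linarith [hn1 n])) (hz1 n x)
  let F : ℕ → I → ℝ := fun n x => y x * Real.log (z n x) - (z n x - 1)
  have hFm : ∀ n, Measurable (F n) := fun n =>
    (hym.mul (Real.measurable_log.comp (hzm n))).sub ((hzm n).sub_const 1)
  have hF0 : ∀ n x, 0 ≤ F n x := fun n x =>
    (klFun_nonneg (hz0 n x).le).trans (klFun_clamp_le (hn1 n))
  have hFint : ∀ n, ∫⁻ x, ENNReal.ofReal (F n x) ≤ ENNReal.ofReal C := fun n => by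
    have hlm : Measurable fun x => Real.log (z n x) := Real.measurable_log.comp (hzm n)
    have hlb : ∀ x, |Real.log (z n x)| ≤ Real.log ((n : ℝ) + 1) := fun x => by
      refine abs_le.2 ⟨?_, Real.log_le_log (hz0 n x) (hz2 n x)⟩
      rw [← Real.log_inv]
      exact Real.log_le_log (inv_pos.2 (by linarith [hn1 n])) (hz1 n x)
    have h1 := h _ _ hlm hlb
    have i1 : Integrable (fun x => y x * Real.log (z n x)) volume :=
      (integrable_rnDeriv_smul_iff hμ).2 (Integrable.of_bound hlm.aestronglyMeasurable _
        (Eventually.of_forall hlb))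
    have i2 : Integrable (fun x => z n x - 1) (volume : Measure I) :=
      (Integrable.of_bound (hzm n).aestronglyMeasurable ((n : ℝ) + 1)
        (Eventually.of_forall fun x => by
          rw [Real.norm_eq_abs, abs_of_pos (hz0 n x)]; exact hz2 n x)).sub (integrable_const 1)
    have h2 : ∫ x, F n x = (∫ x, Real.log (z n x) ∂μ) - ∫ x, (z n x - 1) := by
      rw [integral_sub i1 i2, ← integral_rnDeriv_smul hμ]
      rfl
    simp_rw [Real.exp_log (hz0 n _)] at h1
    have i3 : Integrable (F n) volume := i1.sub i2
    rw [← ofReal_integral_eq_lintegral_ofReal i3 (Eventually.of_forall (hF0 n))]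
    refine ENNReal.ofReal_le_ofReal ?_
    linarith
  calc ∫⁻ x, ENNReal.ofReal (klFun (y x))
      = ∫⁻ x, liminf (fun n => ENNReal.ofReal (F n x)) atTop :=
        lintegral_congr fun x =>
          (ENNReal.tendsto_ofReal (tendsto_mul_log_clamp (hy0 x))).liminf_eq.symm
    _ ≤ liminf (fun n => ∫⁻ x, ENNReal.ofReal (F n x)) atTop :=
        lintegral_liminf_le fun n => (hFm n).ennreal_ofReal
    _ ≤ liminf (fun _ : ℕ => ENNReal.ofReal C) atTop :=
        liminf_le_liminf (Eventually.of_forall hFint)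
    _ = ENNReal.ofReal C := liminf_const _

/-- Lower semicontinuity of the entropy with respect to weak convergence. -/
theorem klDiv_le_of_tendsto {μs : ℕ → ProbabilityMeasure I} {μ : ProbabilityMeasure I}
    (h : Tendsto μs atTop (𝓝 μ)) (hac : ∀ n, (μs n : Measure I) ≪ volume)
    (hμ : (μ : Measure I) ≪ volume) {C : ℝ≥0}
    (hC : ∀ᶠ n in atTop, klDiv (μs n : Measure I) volume ≤ C) :
    klDiv (μ : Measure I) volume ≤ C := by
  have hcont : ∀ g : I → ℝ, Continuous g →
      ∫ x, g x ∂(μ : Measure I) ≤ C + ∫ x, (Real.exp (g x) - 1) := fun g hg => by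
    let g' := BoundedContinuousFunction.mkOfCompact ⟨g, hg⟩
    have h1 := ProbabilityMeasure.tendsto_iff_forall_integral_tendsto.1 h g'
    refine le_of_tendsto h1 (hC.mono fun n hn => ?_)
    exact integral_le_klDiv_add (hac n) hn hg.measurable fun x => g'.norm_coe_le_norm x
  have h2 := klDiv_le_of_forall_integral_le hμ fun g M hg hM =>
    integral_le_of_forall_continuous hμ hcont hg hM
  rwa [ENNReal.ofReal_coe_nnreal] at h2

/-! ### Attainment, lower semicontinuity and the zero set -/

/-- The infimum defining `K` is attained, also along convergent sequences of graphons. -/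
theorem exists_entropy_le (W U : Graphon) {μs : ℕ → ACProb} {ρ : ℝ≥0}
    (hρ : ∀ C : ℝ≥0, ρ < C → ∀ᶠ n in atTop, klDiv (μs n).1 volume ≤ C)
    (hU : Tendsto (fun n => cutDist U (W.reweight (μs n))) atTop (𝓝 0)) :
    ∃ μ : ACProb, klDiv μ.1 volume ≤ ρ ∧ WeakIso U (W.reweight μ) := by
  -- Past $N$ the entropies are bounded by $\rho+1$, which gives uniform absolute continuity; the
  -- sharp bound $\rho$ is recovered only in the limit.
  obtain ⟨N, hN⟩ := eventually_atTop.1 (hρ (ρ + 1) (by simp))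
  obtain ⟨μ, ms, hms, hlim⟩ :=
    SeqCompactSpace.tendsto_subseq fun n => (μs (N + n)).toProb
  let νs : ℕ → ACProb := fun k => μs (N + ms k)
  have hνlim : Tendsto (fun k => (νs k).toProb) atTop (𝓝 μ) := hlim
  have hsub : Tendsto (fun k => N + ms k) atTop atTop :=
    tendsto_atTop_mono (fun k => Nat.le_add_left _ _) hms.tendsto_atTop
  have hUAC : UnifAC (range fun k => (νs k).1) := by
    refine (unifAC_of_klDiv_le (C := (ρ + 1 : ℝ≥0)) ENNReal.coe_ne_top).mono ?_
    rintro _ ⟨k, rfl⟩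
    exact ⟨(νs k).2.1, (νs k).2.2, hN _ (Nat.le_add_right _ _)⟩
  have hac : (μ : Measure I) ≪ volume := absolutelyContinuous_of_tendsto hνlim hUAC
  let μ' : ACProb := ⟨μ, inferInstance, hac⟩
  refine ⟨μ', ?_, ?_⟩
  · refine le_of_forall_gt_imp_ge_of_dense fun C hC => ?_
    rcases eq_or_ne C ∞ with rfl | hCtop
    · exact le_top
    lift C to ℝ≥0 using hCtop
    exact klDiv_le_of_tendsto hνlim (fun k => (νs k).2.2) hac
      (hsub.eventually (hρ C (ENNReal.coe_lt_coe.1 hC)))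
  · obtain ⟨ns, hns, h1⟩ := W.exists_subseq_tendsto_cutDist (μ := μ') hνlim hUAC
    have h2 := ((hU.comp hsub).comp hns.tendsto_atTop).add h1
    rw [add_zero] at h2
    refine le_antisymm (ge_of_tendsto' h2 fun k => ?_) (cutDist_nonneg _ _)
    exact cutDist_triangle _ _ _

theorem entropy_nonneg (μ : ACProb) : 0 ≤ entropy μ := by
  rw [entropy_eq_klDiv]
  exact EReal.coe_ennreal_nonneg _

theorem K_nonneg (W U : Graphon) : 0 ≤ K W U := by
  refine le_sInf ?_
  rintro r ⟨μ, -, rfl⟩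
  exact entropy_nonneg μ

theorem K_le {W U : Graphon} {μ : ACProb} (h : WeakIso U (W.reweight μ)) :
    K W U ≤ (klDiv μ.1 volume : ℝ≥0∞) :=
  sInf_le ⟨μ, h, (entropy_eq_klDiv μ).symm⟩

theorem exists_of_K_lt {W U : Graphon} {r : EReal} (h : K W U < r) :
    ∃ μ : ACProb, WeakIso U (W.reweight μ) ∧ ((klDiv μ.1 volume : ℝ≥0∞) : EReal) < r := by
  rw [K, sInf_lt_iff] at h
  obtain ⟨_, ⟨μ, h1, rfl⟩, h2⟩ := h
  exact ⟨μ, h1, by rwa [entropy_eq_klDiv] at h2⟩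

theorem exists_entropy_le_of_mem_cutClosure (W : Graphon) {U : Graphon} {ρ : ℝ≥0}
    (h : U ∈ cutClosure {V | K W V ≤ ((ρ : ℝ) : EReal)}) :
    ∃ μ : ACProb, klDiv μ.1 volume ≤ ρ ∧ WeakIso U (W.reweight μ) := by
  have hex : ∀ n : ℕ, ∃ μ : ACProb, cutDist U (W.reweight μ) ≤ 1 / ((n : ℝ) + 1) ∧
      ((klDiv μ.1 volume : ℝ≥0∞) : EReal) < ((ρ + 1 / ((n : ℝ) + 1) : ℝ) : EReal) := fun n => by
    have hn : (0 : ℝ) < 1 / ((n : ℝ) + 1) := by positivity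
    obtain ⟨V, hV, hUV⟩ := h _ hn
    obtain ⟨μ, h1, h2⟩ := exists_of_K_lt
      (lt_of_le_of_lt hV (EReal.coe_lt_coe_iff.2 (lt_add_of_pos_right (ρ : ℝ) hn)))
    refine ⟨μ, ?_, h2⟩
    have h3 := cutDist_triangle U V (W.reweight μ)
    rw [WeakIso] at h1
    linarith
  choose μs h1 h2 using hex
  refine exists_entropy_le W U (μs := μs) (fun C hC => ?_)
    (squeeze_zero (fun n => cutDist_nonneg _ _) h1 tendsto_one_div_add_atTop_nhds_zero_nat)
  have hC' : (0 : ℝ) < C - ρ := sub_pos.2 (NNReal.coe_lt_coe.2 hC)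
  filter_upwards [(tendsto_one_div_add_atTop_nhds_zero_nat (𝕜 := ℝ)).eventually_lt_const hC']
    with n hn
  refine EReal.coe_ennreal_le_coe_ennreal_iff.1 ((h2 n).le.trans ?_)
  rw [EReal.coe_nnreal_eq_coe_real]
  exact EReal.coe_le_coe_iff.2 (by linarith)

theorem cutLowerSemicontinuous_K (W : Graphon) : CutLowerSemicontinuous (K W) := by
  intro ρ U hU
  obtain ⟨V, hV, -⟩ := hU 1 one_pos
  -- A sublevel set with a point in its closure is nonempty, which excludes negative levels.
  have hρ : 0 ≤ ρ := EReal.coe_nonneg.1 ((K_nonneg W V).trans hV)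
  lift ρ to ℝ≥0 using hρ
  obtain ⟨μ, h1, h2⟩ := W.exists_entropy_le_of_mem_cutClosure hU
  refine (K_le h2).trans ?_
  rw [← EReal.coe_nnreal_eq_coe_real]
  exact EReal.coe_ennreal_le_coe_ennreal_iff.2 h1

theorem K_eq_zero_iff (W U : Graphon) : K W U = 0 ↔ WeakIso W U := by
  constructor
  · intro h
    -- $U$ lies in the closure of its own sublevel set, so the value $0$ is attained, necessarily at
    -- $\mu=\lambda$.
    obtain ⟨μ, h1, h2⟩ := W.exists_entropy_le_of_mem_cutClosure (U := U) (ρ := 0)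
      fun ε hε => ⟨U, by simp [h], by rwa [cutDist_self]⟩
    have := μ.isProbabilityMeasure
    have h3 : μ = acVolume :=
      Subtype.ext ((klDiv_eq_zero_iff (ν := volume)).1 (le_antisymm h1 zero_le))
    rw [h3] at h2
    exact W.weakIso_reweight_acVolume.trans h2.symm
  · intro h
    refine le_antisymm ?_ (K_nonneg W U)
    refine (K_le (h.symm.trans W.weakIso_reweight_acVolume)).trans ?_
    have : klDiv acVolume.1 volume = 0 := klDiv_self volume
    rw [this]
    rfl

/-! ### Density of the finite-value set -/

theorem klDiv_ne_top_of_le_smul {ν : Measure I} [IsFiniteMeasure ν] {c : ℝ≥0}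
    (h : ν ≤ c • (volume : Measure I)) : klDiv ν volume ≠ ∞ := by
  have hac : ν ≪ volume := Measure.absolutelyContinuous_of_le_smul (c := c) h
  rw [klDiv_eq_lintegral_klFun_of_ac hac]
  have hle : ν.rnDeriv volume ≤ᵐ[volume] fun _ => (c : ℝ≥0∞) := by
    refine ae_le_of_forall_setLIntegral_le_of_sigmaFinite (Measure.measurable_rnDeriv _ _)
      fun s _ _ => ?_
    rw [Measure.setLIntegral_rnDeriv hac, setLIntegral_const]
    exact h s
  refine ne_top_of_le_ne_top (b := ENNReal.ofReal ((c : ℝ) ^ 2 + 1)) ENNReal.ofReal_ne_top ?_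
  calc ∫⁻ x, ENNReal.ofReal (klFun (ν.rnDeriv volume x).toReal)
      ≤ ∫⁻ _ : I, ENNReal.ofReal ((c : ℝ) ^ 2 + 1) := by
        refine lintegral_mono_ae (hle.mono fun x hx => ENNReal.ofReal_le_ofReal ?_)
        have h1 : (ν.rnDeriv volume x).toReal ≤ c := ENNReal.toReal_mono ENNReal.coe_ne_top hx
        have h0 : 0 ≤ (ν.rnDeriv volume x).toReal := ENNReal.toReal_nonneg
        generalize (ν.rnDeriv volume x).toReal = y at h0 h1
        have h2 := mul_le_mul_of_nonneg_left (Real.log_le_self h0) h0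
        rw [klFun_apply]
        nlinarith
    _ = _ := by simp

/-- Conditioning on a measurable set of positive measure, as an element of `ACProb`. -/
def ACProb.cond (μ : ACProb) (A : Set I) (hA : μ.1 A ≠ 0) : ACProb :=
  have := μ.2.1
  ⟨ProbabilityTheory.cond μ.1 A, ProbabilityTheory.cond_isProbabilityMeasure hA,
    (ProbabilityTheory.cond_absolutelyContinuous).trans μ.2.2⟩

theorem ACProb.cond_le (μ : ACProb) {A : Set I} (hA : μ.1 A ≠ 0) {c : ℝ≥0}
    (hc : (c : ℝ≥0∞)⁻¹ ≤ μ.1 A) : (μ.cond A hA).1 ≤ c • μ.1.restrict A := by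
  refine Measure.le_iff.2 fun s _ => ?_
  change (μ.1 A)⁻¹ * μ.1.restrict A s ≤ c * μ.1.restrict A s
  gcongr
  exact ENNReal.inv_le_iff_inv_le.1 hc

theorem tendsto_setIntegral_of_eventually_mem {μ : Measure I} {A : ℕ → Set I}
    (hA : ∀ n, MeasurableSet (A n)) (h : ∀ᵐ x ∂μ, ∀ᶠ n in atTop, x ∈ A n) {g : I → ℝ}
    (hg : Integrable g μ) :
    Tendsto (fun n => ∫ x in A n, g x ∂μ) atTop (𝓝 (∫ x, g x ∂μ)) := by
  simp_rw [← integral_indicator (hA _)]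
  refine tendsto_integral_of_dominated_convergence (fun x => ‖g x‖)
    (fun n => hg.aestronglyMeasurable.indicator (hA n)) hg.norm
    (fun n => Eventually.of_forall fun x => norm_indicator_le_norm_self _ _) ?_
  filter_upwards [h] with x hx
  refine tendsto_const_nhds.congr' ?_
  filter_upwards [hx] with n hn
  rw [indicator_of_mem hn]

/-- Conditioning $\mu$ on $\{f\le n\}$ gives bounded density, hence finite divergence. These
measures converge weakly to $\mu$ and are dominated by $2\mu$ once the conditioning set has mass at
least $1/2$, hence are uniformly absolutely continuous. -/
theorem exists_klDiv_ne_top_cutDist_lt (W : Graphon) (μ : ACProb) {ε : ℝ} (hε : 0 < ε) :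
    ∃ ν : ACProb, klDiv ν.1 volume ≠ ∞ ∧ cutDist (W.reweight ν) (W.reweight μ) < ε := by
  have := μ.isProbabilityMeasure
  set f : I → ℝ≥0∞ := μ.1.rnDeriv volume with hf
  have hfm : Measurable f := Measure.measurable_rnDeriv _ _
  let A : ℕ → Set I := fun n => {x | f x ≤ n}
  have hA : ∀ n, MeasurableSet (A n) := fun n => measurableSet_le hfm measurable_const
  have hev : ∀ᵐ x ∂μ.1, ∀ᶠ n in atTop, x ∈ A n := by
    filter_upwards [μ.2.2.ae_le (Measure.rnDeriv_lt_top μ.1 volume)] with x hx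
    obtain ⟨N, hN⟩ := ENNReal.exists_nat_gt hx.ne
    filter_upwards [eventually_ge_atTop N] with n hn
    exact hN.le.trans (by exact_mod_cast hn)
  have hreal : Tendsto (fun n => μ.1.real (A n)) atTop (𝓝 1) := by
    simpa using tendsto_setIntegral_of_eventually_mem hA hev (integrable_const (1 : ℝ))
  obtain ⟨N, hN⟩ := eventually_atTop.1
    (hreal.eventually_const_le (show (2 : ℝ)⁻¹ < 1 by norm_num))
  have hhalf : ∀ n, ((2 : ℝ≥0) : ℝ≥0∞)⁻¹ ≤ μ.1 (A (N + n)) := fun n => by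
    rw [← ofReal_measureReal (measure_ne_top μ.1 _), ← ENNReal.coe_inv two_ne_zero,
      ← ENNReal.ofReal_coe_nnreal]
    exact ENNReal.ofReal_le_ofReal (by simpa using hN _ (Nat.le_add_right N n))
  have hne : ∀ n, μ.1 (A (N + n)) ≠ 0 := fun n =>
    (lt_of_lt_of_le (by simp) (hhalf n)).ne'
  let νs : ℕ → ACProb := fun n => μ.cond (A (N + n)) (hne n)
  have hshift : Tendsto (fun n => N + n) atTop atTop :=
    tendsto_atTop_mono (fun n => Nat.le_add_left _ _) tendsto_id
  have hlim : Tendsto (fun n => (νs n).toProb) atTop (𝓝 μ.toProb) := by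
    refine ProbabilityMeasure.tendsto_iff_forall_integral_tendsto.2 fun g => ?_
    have h1 := (tendsto_setIntegral_of_eventually_mem hA hev (g.integrable μ.1)).comp hshift
    have h2 := ((hreal.comp hshift).inv₀ one_ne_zero).mul h1
    rw [inv_one, one_mul] at h2
    refine h2.congr fun n => ?_
    change _ = ∫ x, g x ∂((μ.1 (A (N + n)))⁻¹ • μ.1.restrict (A (N + n)))
    rw [integral_smul_measure, ENNReal.toReal_inv]
    rfl
  have hUAC : UnifAC (range fun n => (νs n).1) := by
    refine (unifAC_singleton μ.2.2).of_le_smul (c := 2) ?_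
    rintro _ ⟨n, rfl⟩
    refine ⟨μ.1, rfl, (μ.cond_le (hne n) (hhalf n)).trans ?_⟩
    exact Measure.le_iff.2 fun s _ => by
      change (2 : ℝ≥0) * μ.1.restrict (A (N + n)) s ≤ (2 : ℝ≥0) * μ.1 s
      gcongr
      exact Measure.restrict_le_self
  obtain ⟨ns, -, hns⟩ := W.exists_subseq_tendsto_cutDist hlim hUAC
  obtain ⟨k, hk⟩ := (hns.eventually_lt_const hε).exists
  refine ⟨νs (ns k), ?_, hk⟩
  have := (νs (ns k)).isProbabilityMeasure
  refine klDiv_ne_top_of_le_smul (c := 2 * (N + ns k : ℕ))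
    ((μ.cond_le (hne _) (hhalf _)).trans ?_)
  refine Measure.le_iff.2 fun s hs => ?_
  change (2 : ℝ≥0) * μ.1.restrict (A (N + ns k)) s
    ≤ ((2 * (N + ns k : ℕ) : ℝ≥0) : ℝ≥0∞) * volume s
  rw [Measure.restrict_apply hs, ENNReal.coe_mul, mul_assoc]
  gcongr
  rw [← Measure.setLIntegral_rnDeriv μ.2.2]
  calc ∫⁻ x in s ∩ A (N + ns k), f x
      ≤ ∫⁻ _ in s ∩ A (N + ns k), ((N + ns k : ℕ) : ℝ≥0∞) :=
        setLIntegral_mono measurable_const fun x hx => hx.2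
    _ = (N + ns k : ℕ) * volume (s ∩ A (N + ns k)) := setLIntegral_const _ _
    _ ≤ _ := by
        gcongr
        · simp
        · exact inter_subset_left

theorem reweight_mem_RN (W : Graphon) (μ : ACProb) : W.reweight μ ∈ RN W := fun ε hε =>
  ⟨W.reweight μ, ⟨μ, cutDist_self _⟩, by rwa [cutDist_self]⟩

theorem setOf_K_lt_top_subset_RN (W : Graphon) : {U : Graphon | K W U < ⊤} ⊆ RN W := by
  intro U hU ε hε
  obtain ⟨μ, h, -⟩ := exists_of_K_lt hU
  exact ⟨U, ⟨μ, h⟩, by rwa [cutDist_self]⟩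

theorem K_reweight_lt_top (W : Graphon) {μ : ACProb} (h : klDiv μ.1 volume ≠ ∞) :
    K W (W.reweight μ) < ⊤ :=
  (K_le (cutDist_self _)).trans_lt (by simpa [lt_top_iff_ne_top] using h)

theorem RN_subset_cutClosure (W : Graphon) : RN W ⊆ cutClosure {U : Graphon | K W U < ⊤} := by
  intro U hU ε hε
  obtain ⟨V, ⟨μ, hμ⟩, hV⟩ := hU (ε / 2) (half_pos hε)
  obtain ⟨ν, hν, hνμ⟩ := W.exists_klDiv_ne_top_cutDist_lt μ (half_pos hε)
  refine ⟨W.reweight ν, W.K_reweight_lt_top hν, ?_⟩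
  have h1 := cutDist_triangle U V (W.reweight ν)
  have h2 := cutDist_triangle V (W.reweight μ) (W.reweight ν)
  rw [cutDist_comm] at hνμ
  rw [WeakIso] at hμ
  linarith

/-! ### Edge density and non-constant graphons -/

/-- The edge density of a graphon. -/
def edgeDensity (U : Graphon) : ℝ := ∫ p : I × I, U.toFun p.1 p.2

theorem edgeDensity_pullback (W : Graphon) {φ : I → I} {μ : Measure I} (hφ : MeasPres φ μ)
    (hμ : μ ≪ volume) :
    edgeDensity (W.pullback φ hφ hμ) = ∫ p, W.toFun p.1 p.2 ∂(μ.prod μ) := by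
  obtain ⟨ψ, hψ, hφψ⟩ := hφ.aemeasurable
  have hψ' := hφ.congr hφψ
  have : IsFiniteMeasure μ := by
    rw [← hψ'.map_eq]
    exact Measure.isFiniteMeasure_map _ _
  have hmap : (volume : Measure (I × I)).map (Prod.map ψ ψ) = μ.prod μ := by
    rw [Measure.volume_eq_prod, ← Measure.map_prod_map _ _ hψ hψ, hψ'.map_eq]
  have hW : AEStronglyMeasurable (fun p : I × I => W.toFun p.1 p.2)
      (volume.map (Prod.map ψ ψ)) := by
    rw [hmap]
    exact W.aestronglyMeasurable.mono_ac (absolutelyContinuous_prod hμ)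
  rw [← hmap, integral_map (hψ.prodMap hψ).aemeasurable hW]
  exact integral_congr_ae (W.toFun_comp_ae_eq hφψ)

theorem integrable_toFun (W : Graphon) :
    Integrable (fun p : I × I => W.toFun p.1 p.2) volume :=
  Integrable.of_bound W.aestronglyMeasurable 1 (Eventually.of_forall fun p => by
    rw [Real.norm_eq_abs, abs_of_nonneg (W.nonneg _ _)]; exact W.le_one _ _)

theorem edgeDensity_pull (W : Graphon) {φ : I → I} (hφ : MeasPres φ volume) :
    edgeDensity (W.pull hφ) = edgeDensity W := by
  rw [pull, edgeDensity_pullback, ← Measure.volume_eq_prod]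
  rfl

theorem abs_edgeDensity_sub_le (U V : Graphon) :
    |edgeDensity U - edgeDensity V| ≤ cutDist U V := by
  refine le_csInf ⟨_, id, id, MeasPres.id, MeasPres.id, rfl⟩ ?_
  rintro r ⟨φ, ψ, hφ, hψ, rfl⟩
  rw [← U.edgeDensity_pull hφ, ← V.edgeDensity_pull hψ, edgeDensity, edgeDensity,
    ← integral_sub (integrable_toFun _) (integrable_toFun _)]
  have := abs_setIntegral_le_cutNormDist (U.pull hφ) (V.pull hψ) (A := univ) (B := univ)
    MeasurableSet.univ.nullMeasurableSet MeasurableSet.univ.nullMeasurableSet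
  rwa [univ_prod_univ, setIntegral_univ] at this

theorem WeakIso.edgeDensity_eq {U V : Graphon} (h : WeakIso U V) :
    edgeDensity U = edgeDensity V := by
  have := abs_edgeDensity_sub_le U V
  rw [h] at this
  exact sub_eq_zero.1 (abs_nonpos_iff.1 this)

/-- The integral of a graphon over a rectangle. -/
def rectIntegral (W : Graphon) (A B : Set I) : ℝ := ∫ p in A ×ˢ B, W.toFun p.1 p.2

theorem rectIntegral_comm (W : Graphon) (A B : Set I) :
    rectIntegral W A B = rectIntegral W B A := by
  rw [rectIntegral, rectIntegral, Measure.volume_eq_prod, ← Measure.prod_restrict,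
    ← Measure.prod_restrict, ← integral_prod_swap]
  simp only [Prod.fst_swap, Prod.snd_swap, W.symm]

theorem rectIntegral_union_left (W : Graphon) {A A' B : Set I} (hA' : MeasurableSet A')
    (hB : MeasurableSet B) (h : Disjoint A A') :
    rectIntegral W (A ∪ A') B = rectIntegral W A B + rectIntegral W A' B := by
  rw [rectIntegral, union_prod, setIntegral_union (h.set_prod_left B B) (hA'.prod hB)
    W.integrable_toFun.integrableOn W.integrable_toFun.integrableOn]
  rfl

theorem rectIntegral_union_right (W : Graphon) {A B B' : Set I} (hA : MeasurableSet A)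
    (hB' : MeasurableSet B') (h : Disjoint B B') :
    rectIntegral W A (B ∪ B') = rectIntegral W A B + rectIntegral W A B' := by
  rw [rectIntegral_comm, rectIntegral_union_left W hB' hA h, rectIntegral_comm,
    rectIntegral_comm W B']

/-- Polarisation: for disjoint $A,B$ expand the hypothesis on $A\cup B$ and use symmetry of $W$; in
general split off $A\cap B$. -/
theorem rectIntegral_eq_of_forall_self {W : Graphon} {c : ℝ}
    (h : ∀ A, MeasurableSet A → rectIntegral W A A = c * volume.real A ^ 2) {A B : Set I}
    (hA : MeasurableSet A) (hB : MeasurableSet B) :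
    rectIntegral W A B = c * (volume.real A * volume.real B) := by
  have hdisj : ∀ A B : Set I, MeasurableSet A → MeasurableSet B → Disjoint A B →
      rectIntegral W A B = c * (volume.real A * volume.real B) := fun A B hA hB hAB => by
    have h1 := h (A ∪ B) (hA.union hB)
    rw [rectIntegral_union_left W hB (hA.union hB) hAB, rectIntegral_union_right W hA hB hAB,
      rectIntegral_union_right W hB hB hAB, h A hA, h B hB, rectIntegral_comm W B A,
      measureReal_union hAB hB] at h1
    linear_combination h1 / 2
  have hAu : (A ∩ B) ∪ (A \ B) = A := inter_union_sdiff A B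
  have hBu : (A ∩ B) ∪ (B \ A) = B := by rw [inter_comm]; exact inter_union_sdiff B A
  have dA : Disjoint (A ∩ B) (A \ B) := disjoint_sdiff_right.mono_left inter_subset_right
  have dB : Disjoint (A ∩ B) (B \ A) := disjoint_sdiff_right.mono_left inter_subset_left
  have hI := hA.inter hB
  have vA : volume.real A = volume.real (A ∩ B) + volume.real (A \ B) := by
    rw [← measureReal_union dA (hA.diff hB), hAu]
  have vB : volume.real B = volume.real (A ∩ B) + volume.real (B \ A) := by
    rw [← measureReal_union dB (hB.diff hA), hBu]
  have e1 : rectIntegral W A B = rectIntegral W (A ∩ B) B + rectIntegral W (A \ B) B := by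
    rw [← rectIntegral_union_left W (hA.diff hB) hB dA, hAu]
  have e2 : rectIntegral W (A ∩ B) B
      = rectIntegral W (A ∩ B) (A ∩ B) + rectIntegral W (A ∩ B) (B \ A) := by
    rw [← rectIntegral_union_right W hI (hB.diff hA) dB, hBu]
  rw [e1, e2, h _ hI, hdisj _ _ hI (hB.diff hA) dB,
    hdisj _ _ (hA.diff hB) hB disjoint_sdiff_left, vA, vB]
  ring

/-- The measures with densities $c$ and $W$ agree on measurable rectangles, hence everywhere, so the
densities agree almost everywhere. -/
theorem isConstant_of_rectIntegral {W : Graphon} {c : ℝ} (hc : 0 ≤ c)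
    (h : ∀ A B, MeasurableSet A → MeasurableSet B →
      rectIntegral W A B = c * (volume.real A * volume.real B)) : W.IsConstant := by
  have hWm : AEMeasurable (fun p : I × I => ENNReal.ofReal (W.toFun p.1 p.2)) volume :=
    W.measurable.aemeasurable.ennreal_ofReal
  have h0 : ∀ S : Set (I × I), ∫⁻ p in S, ENNReal.ofReal (W.toFun p.1 p.2)
      = ENNReal.ofReal (∫ p in S, W.toFun p.1 p.2) := fun S =>
    (ofReal_integral_eq_lintegral_ofReal W.integrable_toFun.integrableOn
      (Eventually.of_forall fun p => W.nonneg _ _)).symm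
  have : IsFiniteMeasure (ENNReal.ofReal c • (volume : Measure I)) :=
    Measure.smul_finite _ ENNReal.ofReal_ne_top
  have h1 : (ENNReal.ofReal c • (volume : Measure I)).prod volume
      = volume.withDensity fun p : I × I => ENNReal.ofReal (W.toFun p.1 p.2) := by
    refine Measure.prod_eq fun A B hA hB => ?_
    rw [withDensity_apply _ (hA.prod hB), h0]
    change ENNReal.ofReal (rectIntegral W A B) = ENNReal.ofReal c * volume A * volume B
    rw [h A B hA hB, ENNReal.ofReal_mul hc, ENNReal.ofReal_mul measureReal_nonneg,
      ofReal_measureReal, ofReal_measureReal, mul_assoc]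
  rw [Measure.prod_smul_left, ← Measure.volume_eq_prod, ← withDensity_const] at h1
  have hne : ∫⁻ _ : I × I, ENNReal.ofReal c ≠ ∞ := by simp
  refine ⟨c, ?_⟩
  filter_upwards [(withDensity_eq_iff aemeasurable_const hWm hne).1 h1] with p hp
  exact ((ENNReal.ofReal_eq_ofReal_iff hc (W.nonneg _ _)).1 hp).symm

/-- A non-constant graphon has a re-weighting by a measure of bounded density which is not weakly
isomorphic to it. -/
theorem exists_not_weakIso_reweight {W : Graphon} (hW : ¬ W.IsConstant) :
    ∃ μ : ACProb, klDiv μ.1 volume ≠ ∞ ∧ ¬ WeakIso W (W.reweight μ) := by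
  -- Otherwise conditioning $\lambda$ on any non-null $A$ preserves the edge density, that is, the
  -- average of $W$ over $A\times A$ does not depend on $A$.
  by_contra! hcon
  refine hW (isConstant_of_rectIntegral (c := edgeDensity W)
    (integral_nonneg fun p => W.nonneg _ _) fun A B hA hB =>
      rectIntegral_eq_of_forall_self (fun A hA => ?_) hA hB)
  by_cases h0 : volume A = 0
  · have : (volume : Measure (I × I)) (A ×ˢ A) = 0 := by
      rw [Measure.volume_eq_prod, Measure.prod_prod, h0, zero_mul]
    rw [rectIntegral, setIntegral_measure_zero _ this, measureReal_def, h0]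
    simp
  have h0' : acVolume.1 A ≠ 0 := h0
  let μ : ACProb := acVolume.cond A h0'
  have := μ.isProbabilityMeasure
  have hfin : klDiv μ.1 volume ≠ ∞ := by
    refine klDiv_ne_top_of_le_smul (c := (volume A).toNNReal⁻¹)
      ((acVolume.cond_le h0' (c := (volume A).toNNReal⁻¹) ?_).trans ?_)
    · rw [ENNReal.coe_inv (ENNReal.toNNReal_ne_zero.2 ⟨h0, measure_ne_top _ _⟩),
        ENNReal.coe_toNNReal (measure_ne_top _ _), inv_inv]
      rfl
    · refine Measure.le_iff.2 fun s _ => ?_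
      change _ * (volume : Measure I).restrict A s ≤ _ * volume s
      gcongr
      exact Measure.restrict_le_self
  have h1 := (hcon μ hfin).edgeDensity_eq
  rw [reweight, edgeDensity_pullback] at h1
  change _ = ∫ p, W.toFun p.1 p.2 ∂(((volume A)⁻¹ • volume.restrict A).prod
    ((volume A)⁻¹ • volume.restrict A)) at h1
  rw [Measure.prod_smul_left, Measure.prod_smul_right, integral_smul_measure,
    integral_smul_measure, Measure.prod_restrict, ← Measure.volume_eq_prod,
    ENNReal.toReal_inv] at h1
  change _ = (volume.real A)⁻¹ * ((volume.real A)⁻¹ * rectIntegral W A A) at h1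
  have h2 : volume.real A ≠ 0 := (measureReal_ne_zero_iff (measure_ne_top _ _)).2 h0
  rw [h1]
  field_simp

end Graphon

end

theorem mainTheorem6 (W : Graphon) :
    -- `K_W` is well defined on weak isomorphism classes
    (∀ U V : Graphon, Graphon.cutDist U V = 0 → Graphon.K W U = Graphon.K W V) ∧
    -- non-negativity
    (∀ U : Graphon, 0 ≤ Graphon.K W U) ∧
    -- the zero set
    (∀ U : Graphon, Graphon.K W U = 0 ↔ Graphon.cutDist W U = 0) ∧
    -- the finite-value set is a dense subset of `RN(W)`
    ({U : Graphon | Graphon.K W U < ⊤} ⊆ Graphon.RN W ∧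
      Graphon.RN W ⊆ Graphon.cutClosure {U : Graphon | Graphon.K W U < ⊤}) ∧
    -- lower semi-continuity
    Graphon.CutLowerSemicontinuous (Graphon.K W) ∧
    -- the non-constant case
    (¬ W.IsConstant →
      (∃ U ∈ Graphon.RN W, ∃ V ∈ Graphon.RN W, ¬ Graphon.WeakIso U V) ∧
      ∃ U : Graphon, 0 < Graphon.K W U ∧ Graphon.K W U < ⊤) := by
  refine ⟨fun U V h => W.K_congr h, W.K_nonneg, W.K_eq_zero_iff,
    ⟨W.setOf_K_lt_top_subset_RN, W.RN_subset_cutClosure⟩, W.cutLowerSemicontinuous_K,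
    fun hW => ?_⟩
  obtain ⟨μ, hfin, hμ⟩ := Graphon.exists_not_weakIso_reweight hW
  -- $W_\lambda$ stands in for $W$, being weakly isomorphic to it and visibly in $\mathbf{RN}(W)$.
  refine ⟨⟨W.reweight Graphon.acVolume, W.reweight_mem_RN _, W.reweight μ, W.reweight_mem_RN μ,
    fun h => hμ (W.weakIso_reweight_acVolume.trans h)⟩, W.reweight μ, ?_,
    W.K_reweight_lt_top hfin⟩
  exact lt_of_le_of_ne (W.K_nonneg _) fun h => hμ ((W.K_eq_zero_iff _).1 h.symm)
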